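/- For a row-stochastic $d\times d$ matrix $M$ that is ergodic ($M^k>0$ entrywise for some $k\ge1$), let $\pi$ be its stationary distribution, $\pi_\star=\min_i\pi(i)$, and let $\gamma_{\mathrm{ps}}(M)=\max_{k\ge1}\gamma\big((M^\star)^kM^k\big)/k$ be its pseudo-spectral gap, where $M^\star(i,j)=\pi(j)M(j,i)/\pi(i)$ and $\gamma(P)=1-\lambda_2(P)$, with $\lambda_2(P)$ the second largest eigenvalue (counted with multiplicity) of a reversible $P$. Put $\|A\|=\max_i\sum_j|A(i,j)|$. An $(\varepsilon,\delta)$-learner with sample complexity function $m_0$ is a (possibly randomized) map that sends a trajectory $(X_1,\dots,X_m)$, $m\ge1$, of an unknown chain with ergodic transition matrix $M$ and initial distribution $\mu$ on $d$ states to a matrix $\hat M\in\mathbb R^{d\times d}$ such that $\|M-\hat M\|<\varepsilon$ with probability at least $1-\delta$ whenever $m\ge m_0(M,\mu)$; here $m_0(M,\mu)\in\mathbb N\cup\{\infty\}$. There is a universal constant $c>0$ such that for every $0<\varepsilon<1/32$, every $0<\gamma_{\mathrm{ps}}<1/8$ and every $d=6k$ with $k\ge2$ there is a value $\pi_\star>0$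 for which the following holds. For every $(\varepsilon,1/10)$-learner for $d$-state chains, with sample complexity function $m_0$, there is a $d$-state ergodic Markov chain $(M,\mu)$ with pseudo-spectral gap exactly $\gamma_{\mathrm{ps}}$ and minimum stationary probability exactly $\pi_\star$ such that $$m_0(M,\mu)\;\ge\; c\,\max\left\{\frac{d}{\varepsilon^2\pi_\star},\ \frac{\log d}{\gamma_{\mathrm{ps}}\,\pi_\star}\right\}.$$ -/

import Mathlib

open MeasureTheory
open scoped ENNReal

noncomputable section

namespace MarkovLearning

/-- `M` is the transition matrix of an ergodic Markov chain on `d` states: it is row-stochastic and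
some power `M ^ k`, `k ≥ 1`, has only positive entries. -/
def IsErgodicChain {d : ℕ} (M : Matrix (Fin d) (Fin d) ℝ) : Prop :=
  M ∈ Matrix.rowStochastic ℝ (Fin d) ∧ ∃ k : ℕ, 1 ≤ k ∧ ∀ i j, 0 < (M ^ k) i j

/-- `π` is a probability vector with `π M = π`. -/
def IsStationary {d : ℕ} (M : Matrix (Fin d) (Fin d) ℝ) (π : Fin d → ℝ) : Prop :=
  π ∈ stdSimplex ℝ (Fin d) ∧ Matrix.vecMul π M = π

/-- The minimum `π⋆` of the values of a distribution `π`. -/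
def minProb {d : ℕ} (π : Fin d → ℝ) : ℝ := ⨅ i, π i

/-- The second largest real eigenvalue `λ₂` in the list `λ₁ ≥ λ₂ ≥ …` of the eigenvalues of `P`
counted with multiplicity (it is used only for reversible `P`, all of whose eigenvalues are
real). -/
def secondEigenvalue {d : ℕ} (P : Matrix (Fin d) (Fin d) ℝ) : ℝ :=
  (P.charpoly.roots.sort (· ≥ ·)).getD 1 0

/-- The spectral gap `1 - λ₂` of a reversible transition matrix. -/
def spectralGap {d : ℕ} (P : Matrix (Fin d) (Fin d) ℝ) : ℝ := 1 - secondEigenvalue P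

/-- The time reversal `M⋆(i, j) = π(j) M(j, i) / π(i)`. -/
def timeReversal {d : ℕ} (M : Matrix (Fin d) (Fin d) ℝ) (π : Fin d → ℝ) :
    Matrix (Fin d) (Fin d) ℝ :=
  Matrix.of fun i j => π j * M j i / π i

/-- `γ` is the pseudo-spectral gap `max_{k ≥ 1} γ((M⋆)^k M^k) / k` of the chain `M` with stationary
distribution `π`. -/
def HasPseudoSpectralGap {d : ℕ} (M : Matrix (Fin d) (Fin d) ℝ) (π : Fin d → ℝ) (γ : ℝ) : Prop :=
  IsGreatest {x : ℝ | ∃ k : ℕ, 1 ≤ k ∧ x = spectralGap (timeReversal M π ^ k * M ^ k) / k} γ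

/-- The norm `max_i ∑_j |A(i, j)|`. -/
def tvNorm {d : ℕ} (A : Matrix (Fin d) (Fin d) ℝ) : ℝ := ⨆ i, ∑ j, |A i j|

/-- The probability `μ(x₁) ∏_{t < m} M(x_t, x_{t+1})` that the chain with transition matrix `M` and
initial distribution `μ` has the trajectory `x` of length `m = n + 1`. -/
def pathProb {d : ℕ} (M : Matrix (Fin d) (Fin d) ℝ) (μ : Fin d → ℝ) {n : ℕ}
    (x : Fin (n + 1) → Fin d) : ℝ :=
  μ (x 0) * ∏ t : Fin n, M (x t.castSucc) (x t.succ)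

/-- A (randomized) learner for chains on `d` states: for every trajectory, of any length
`m = n + 1 ≥ 1`, the law of the `d × d` matrix that the learner outputs. -/
abbrev Learner (d : ℕ) : Type :=
  (n : ℕ) → (Fin (n + 1) → Fin d) → ProbabilityMeasure (Fin d → Fin d → ℝ)

/-- The probability, over the trajectory of length `n + 1` of the chain `(M, μ)` and the internal
randomness of the learner, that the output `A` has `‖M - A‖ < ε`. -/
def successProb {d : ℕ} (L : Learner d) (ε : ℝ) (M : Matrix (Fin d) (Fin d) ℝ) (μ : Fin d → ℝ)
    (n : ℕ) : ℝ :=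
  ∑ x : Fin (n + 1) → Fin d,
    pathProb M μ x *
      (L n x : Measure (Fin d → Fin d → ℝ)).real {A | tvNorm (M - Matrix.of A) < ε}

/-- `L` is an `(ε, δ)`-learner with sample complexity function `m₀`: for every ergodic chain
`(M, μ)` and every length `m = n + 1 ≥ m₀(M, μ)`, it succeeds with probability at least `1 - δ`.
The value `⊤` of `m₀` means that nothing is guaranteed for the chain. -/
def IsLearner {d : ℕ} (ε δ : ℝ) (L : Learner d)
    (m₀ : Matrix (Fin d) (Fin d) ℝ → (Fin d → ℝ) → ℕ∞) : Prop :=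
  ∀ (M : Matrix (Fin d) (Fin d) ℝ) (μ : Fin d → ℝ),
    IsErgodicChain M → μ ∈ stdSimplex ℝ (Fin d) →
      ∀ n : ℕ, m₀ M μ ≤ ((n + 1 : ℕ) : ℕ∞) → 1 - δ ≤ successProb L ε M μ n

end MarkovLearning

end

/-!
# Lower bounds for learning ergodic Markov chains

Two families of chains are used, according to which term of the maximum dominates: chains whose
hard row sits at a rarely visited state (Assouad's method), and lazy chains with uniform resets
whose pairs of states have to be collected (coupon collector).
-/

namespace MarkovLearning

/-! ### Spectra of `(M⋆)^k M^k` for structured chains. -/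

section Spectrum

open Matrix Polynomial

/-! Both terms of the maximum carry the same factor `1 / π⋆`, so which one dominates is decided by
`ε`, `γ` and `d` alone. Hence a separate family of chains, with its own `π⋆`, may serve each case.
Both families are indexed by bit vectors `τ`, have pseudo-spectral gap `1 - ℓ ^ 2 = γ` for every
`τ`, and force a learner to decode the bits.

If `d / ε ^ 2` dominates, the bits tilt by factors `1 ± β`, `β = 16 ε`, the row of a rare state that
every state enters with probability `p = π⋆`. An `ε`-accurate output has at most `3m/20` wrong bits
(`hamming_le_of_tvNorm_lt`). Only visits to the rare state are informative: flipping one bit leaves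
the Bhattacharyya coefficient of the path laws above `1 - O(n p β ^ 2 / d)` (`affinity_rareChain`),
and Assouad's lemma (`exists_success_lt_of_hamming`) applies. The slow eigenvalue `ℓ` comes from two
sticky states. The tilted row is a rank one perturbation of square zero, so it does not affect the
gap (`hasPseudoSpectralGap_of_rank_three`).

If `log d / γ` dominates, the chain either resets uniformly, with probability `1 - ℓ ≤ γ`, or
applies an involution that swaps or fixes the two states of each pair according to a bit. A new pair
is reached only by a reset, so by the coupon collector effect some pair is unseen for order `d log d
/ γ` steps (`half_le_unvisited`). Its bit can then only be guessed (`exists_success_lt_of_unseen`).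
-/

theorem secondEigenvalue_eq_of_roots {d : ℕ} {P : Matrix (Fin d) (Fin d) ℝ} {a b : ℝ}
    {s : Multiset ℝ} (h : P.charpoly.roots = a ::ₘ b ::ₘ s) (hab : b ≤ a)
    (hs : ∀ c ∈ s, c ≤ b) : secondEigenvalue P = b := by
  have h1 : (b ::ₘ s).sort (· ≥ ·) = b :: s.sort (· ≥ ·) := Multiset.sort_cons _ _ _ hs
  have h2 : (a ::ₘ b ::ₘ s).sort (· ≥ ·) = a :: (b ::ₘ s).sort (· ≥ ·) := by
    apply Multiset.sort_cons
    intro c hc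
    rcases Multiset.mem_cons.1 hc with rfl | hc
    · exact hab
    · exact (hs c hc).trans hab
  rw [secondEigenvalue, h, h2, h1]
  rfl

/-- The second eigenvalue of a matrix of rank at most three with eigenvalues `1`, `t`, `κ`. -/
theorem secondEigenvalue_mul {d : ℕ} (hd : 3 ≤ d) (U : Matrix (Fin d) (Fin 3) ℝ)
    (V : Matrix (Fin 3) (Fin d) ℝ) {t κ : ℝ} (hVU : V * U = diagonal ![1, t, κ])
    (hκ : 0 ≤ κ) (hκt : κ ≤ t) (ht : t ≤ 1) : secondEigenvalue (U * V) = t := by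
  have hc : (U * V).charpoly = X ^ (d - 3) * ((X - C 1) * (X - C t) * (X - C κ)) := by
    rw [charpoly_mul_comm_of_le _ _ (by simpa using hd), hVU, charpoly_diagonal]
    simp [Fin.prod_univ_three]
  have hne : (X - C 1) * (X - C t) * (X - C κ) ≠ 0 :=
    mul_ne_zero (mul_ne_zero (X_sub_C_ne_zero _) (X_sub_C_ne_zero _)) (X_sub_C_ne_zero _)
  have hr : (U * V).charpoly.roots = 1 ::ₘ t ::ₘ κ ::ₘ (d - 3) • {0} := by
    rw [hc, roots_mul (mul_ne_zero (pow_ne_zero _ X_ne_zero) hne), roots_mul hne,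
      roots_mul (mul_ne_zero (X_sub_C_ne_zero _) (X_sub_C_ne_zero _)), roots_X_pow]
    simp only [roots_X_sub_C, ← Multiset.singleton_add]
    abel
  refine secondEigenvalue_eq_of_roots hr ht fun c hc => ?_
  rcases Multiset.mem_cons.1 hc with rfl | hc
  · exact hκt
  · have := Multiset.mem_of_mem_nsmul hc
    rw [Multiset.mem_singleton] at this
    linarith

/-- A rank one matrix with trace `1 - t` has eigenvalues `1 - t` and `0`; adding the scalar `t`
shifts them to `1` and `t`. -/
theorem secondEigenvalue_smul_one_add_vecMulVec {d : ℕ} (hd : 2 ≤ d) (u w : Fin d → ℝ) {t : ℝ}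
    (huw : u ⬝ᵥ w = 1 - t) (ht : t ≤ 1) :
    secondEigenvalue (vecMulVec u w + scalar (Fin d) t) = t := by
  obtain ⟨n, rfl⟩ : ∃ n, d = n + 2 := ⟨d - 2, by omega⟩
  have hc : (vecMulVec u w + scalar (Fin (n + 2)) t).charpoly
      = (X - C t) ^ (n + 1) * (X - C 1) := by
    have := charpoly_sub_scalar (vecMulVec u w) (-t)
    rw [map_neg, sub_neg_eq_add] at this
    rw [this, charpoly_vecMulVec, huw]
    simp only [Fintype.card_fin, smul_eq_C_mul, Nat.add_one_sub_one, sub_comp, pow_comp, X_comp,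
      mul_comp, C_comp, map_neg, map_sub, map_one]
    ring_nf
    simp
  have hr : (vecMulVec u w + scalar (Fin (n + 2)) t).charpoly.roots
      = 1 ::ₘ t ::ₘ n • {t} := by
    rw [hc, roots_mul (mul_ne_zero (pow_ne_zero _ (X_sub_C_ne_zero _)) (X_sub_C_ne_zero _)),
      roots_pow, roots_X_sub_C, roots_X_sub_C, succ_nsmul]
    simp only [← Multiset.singleton_add]
    abel
  refine secondEigenvalue_eq_of_roots hr ht fun c hc => ?_
  have := Multiset.mem_of_mem_nsmul hc
  rw [Multiset.mem_singleton] at this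
  exact this.le

/-- If `(M⋆)^k M^k` has second eigenvalue `ℓ ^ (2k)` for all `k`, the pseudo-spectral gap is
attained at `k = 1`. -/
theorem hasPseudoSpectralGap_of_secondEigenvalue {d : ℕ} {M : Matrix (Fin d) (Fin d) ℝ}
    {π : Fin d → ℝ} {ℓ : ℝ}
    (h : ∀ k : ℕ, 1 ≤ k → secondEigenvalue (timeReversal M π ^ k * M ^ k) = (ℓ ^ 2) ^ k) :
    HasPseudoSpectralGap M π (1 - ℓ ^ 2) := by
  refine ⟨⟨1, le_rfl, ?_⟩, ?_⟩
  · rw [spectralGap, h 1 le_rfl]; simp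
  · rintro x ⟨k, hk, rfl⟩
    rw [spectralGap, h k hk, div_le_iff₀ (by exact_mod_cast hk)]
    -- Bernoulli's inequality: `1 - x ^ k ≤ k (1 - x)` with `x = ℓ ^ 2`, so no `k` beats `k = 1`.
    have := one_add_mul_le_pow (a := ℓ ^ 2 - 1) (by nlinarith [sq_nonneg ℓ]) k
    rw [add_sub_cancel] at this
    linarith

theorem vecMulVec_mul_vecMulVec_eq_smul {d : ℕ} (u v w z : Fin d → ℝ) :
    vecMulVec u v * vecMulVec w z = (v ⬝ᵥ w) • vecMulVec u z := by
  rw [vecMulVec_mul_vecMulVec]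
  ext i j
  simp [vecMulVec_apply]
  ring

/-- A chain that is the sum of its projection to the constants, a rank one self-adjoint part with
eigenvalue `ℓ`, and a nilpotent perturbation of one row. -/
theorem hasPseudoSpectralGap_of_rank_three {d : ℕ} (hd : 3 ≤ d) (o : Fin d)
    (π f v : Fin d → ℝ) {ℓ c : ℝ} (hℓ : 0 ≤ ℓ) (hℓ1 : ℓ ≤ 1) (hπ : ∀ i, 0 < π i)
    (hπ1 : ∑ i, π i = 1) (hv : ∑ i, v i = 0) (hvo : v o = 0) (hf : ∑ i, f i = 0)
    (hπf : ∑ i, π i * f i = 0) (hfv : ∑ i, f i * v i = 0) (hff : ∑ i, f i * f i = 2)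
    (hfo : f o = 0) (hc : ∀ i, π i * f i = c * f i)
    (hκ : π o * (1 - π o) * ∑ i, v i ^ 2 / π i ≤ ℓ ^ 2)
    {M : Matrix (Fin d) (Fin d) ℝ}
    (hM : ∀ i j, M i j = π j + ℓ / 2 * f i * f j + ((if i = o then 1 else 0) - π o) * v j) :
    HasPseudoSpectralGap M π (1 - ℓ ^ 2) := by
  set e : Fin d → ℝ := fun _ => 1
  set h : Fin d → ℝ := fun i => (if i = o then 1 else 0) - π o
  set w : Fin d → ℝ := fun i => v i / π i
  set g : Fin d → ℝ := fun i => h i * π i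
  have hc0 : c ≠ 0 := by
    rintro rfl
    have : ∀ i, f i = 0 := fun i => by
      have := hc i
      rw [zero_mul] at this
      exact (mul_eq_zero.1 this).resolve_left (hπ i).ne'
    simp [this] at hff
  have hπo1 : π o ≤ 1 := hπ1 ▸ Finset.single_le_sum (fun i _ => (hπ i).le) (Finset.mem_univ o)
  have hMe : M = vecMulVec e π + (ℓ / 2) • vecMulVec f f + vecMulVec h v := by
    ext i j; simp [hM, vecMulVec_apply, e, h]; ring
  have hRe : timeReversal M π = vecMulVec e π + (ℓ / 2) • vecMulVec f f + vecMulVec w g := by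
    ext i j
    have hi := hc i
    have hj := hc j
    have hp := (hπ i).ne'
    have hfij : π j * f i * f j = π i * f i * f j := by rw [hi, mul_right_comm, hj]; ring
    simp only [timeReversal, of_apply, hM, Matrix.add_apply, Matrix.smul_apply, vecMulVec_apply, e, g, w, h,
      smul_eq_mul]
    field_simp
    linear_combination ℓ * hfij
  have h_e : π ⬝ᵥ e = 1 := by simp [dotProduct, e, hπ1]
  have h_f : π ⬝ᵥ f = 0 := hπf
  have h_h : π ⬝ᵥ h = 0 := by
    simp [dotProduct, h, mul_sub, Finset.sum_sub_distrib, ← Finset.sum_mul, hπ1]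
  have f_e : f ⬝ᵥ e = 0 := by simp [dotProduct, e, hf]
  have f_f : f ⬝ᵥ f = 2 := hff
  have f_h : f ⬝ᵥ h = 0 := by
    simp [dotProduct, h, mul_sub, Finset.sum_sub_distrib, ← Finset.sum_mul, hf, hfo]
  have v_e : v ⬝ᵥ e = 0 := by simp [dotProduct, e, hv]
  have v_f : v ⬝ᵥ f = 0 := by rw [dotProduct_comm]; exact hfv
  have v_h : v ⬝ᵥ h = 0 := by
    simp [dotProduct, h, mul_sub, Finset.sum_sub_distrib, ← Finset.sum_mul, hv, hvo]
  have π_w : π ⬝ᵥ w = 0 := by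
    rw [dotProduct, ← hv]; exact Finset.sum_congr rfl fun i _ => mul_div_cancel₀ _ (hπ i).ne'
  have f_w : f ⬝ᵥ w = 0 := by
    have : c * (f ⬝ᵥ w) = 0 := by
      rw [dotProduct, Finset.mul_sum, ← hfv]
      refine Finset.sum_congr rfl fun i _ => ?_
      have := (hπ i).ne'
      simp only [w]
      rw [← mul_assoc, ← hc]; field_simp
    exact (mul_eq_zero.1 this).resolve_left hc0
  have g_e : g ⬝ᵥ e = 0 := by rw [← h_h]; simp [dotProduct, e, g, mul_comm]
  have g_f : g ⬝ᵥ f = 0 := by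
    have : g ⬝ᵥ f = c * (f ⬝ᵥ h) := by
      rw [dotProduct, dotProduct, Finset.mul_sum]
      refine Finset.sum_congr rfl fun i _ => ?_
      simp only [g]; linear_combination h i * hc i
    rw [this, f_h, mul_zero]
  have g_h : g ⬝ᵥ h = π o * (1 - π o) := by
    have : ∀ i, g i * h i = (if i = o then π o * (1 - π o) else 0) - π o * (π i * h i) := by
      intro i
      by_cases hi : i = o
      · subst hi; simp [g, h]; ring
      · simp [g, h, hi]; ring
    rw [dotProduct, Finset.sum_congr rfl fun i _ => this i, Finset.sum_sub_distrib,
      ← Finset.mul_sum]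
    have h_h' : ∑ i, π i * h i = 0 := h_h
    simp [h_h']
  have g_w : g ⬝ᵥ w = 0 := by
    rw [← v_h, dotProduct, dotProduct]
    refine Finset.sum_congr rfl fun i _ => ?_
    have := (hπ i).ne'
    simp only [g, w]; field_simp
  -- `v ⬝ᵥ h = 0` and `v` is orthogonal to `e` and `f`, while `π` and `f` are orthogonal to `h`; so
  -- the perturbation disappears from the second power on. Its reversal `vecMulVec w g` behaves in
  -- the same way.
  have hM2 : ∀ k : ℕ, M ^ (k + 2) = vecMulVec e π + (ℓ ^ (k + 2) / 2) • vecMulVec f f := by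
    intro k
    induction k with
    | zero =>
      rw [zero_add, pow_two, hMe]
      simp only [add_mul, mul_add, smul_mul_assoc, mul_smul_comm, vecMulVec_mul_vecMulVec_eq_smul, h_e, h_f,
        h_h, f_e, f_f, f_h, v_e, v_f, v_h, zero_smul, smul_zero, one_smul, add_zero, zero_add,
        smul_smul]
      congr 2; ring
    | succ k ih =>
      rw [show k + 1 + 2 = (k + 2) + 1 by ring, pow_succ', ih, hMe]
      simp only [add_mul, mul_add, smul_mul_assoc, mul_smul_comm, vecMulVec_mul_vecMulVec_eq_smul, h_e, h_f,
        f_e, f_f, v_e, v_f, zero_smul, smul_zero, one_smul, add_zero, zero_add,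
        smul_smul]
      congr 2; ring
  have hR2 : ∀ k : ℕ, timeReversal M π ^ (k + 2)
      = vecMulVec e π + (ℓ ^ (k + 2) / 2) • vecMulVec f f := by
    intro k
    induction k with
    | zero =>
      rw [zero_add, pow_two, hRe]
      simp only [add_mul, mul_add, smul_mul_assoc, mul_smul_comm, vecMulVec_mul_vecMulVec_eq_smul, h_e, h_f,
        f_e, f_f, π_w, f_w, g_e, g_f, g_w, zero_smul, smul_zero, one_smul, add_zero, zero_add,
        smul_smul]
      congr 2; ring
    | succ k ih =>
      rw [show k + 1 + 2 = (k + 2) + 1 by ring, pow_succ', ih, hRe]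
      simp only [add_mul, mul_add, smul_mul_assoc, mul_smul_comm, vecMulVec_mul_vecMulVec_eq_smul, h_e, h_f,
        f_e, f_f, g_e, g_f, zero_smul, smul_zero, one_smul, add_zero, zero_add,
        smul_smul]
      congr 2; ring
  -- Only `k = 1` leaves a trace of the perturbation: a rank one term with eigenvalue `π o (1 - π o)
  -- ∑ v² / π`, which `hκ` keeps below `ℓ ^ 2`. For `k ≥ 2` the witness is `q = 0`.
  have hprod : ∀ k : ℕ, 1 ≤ k → ∃ q : ℝ, 0 ≤ q ∧ q * ∑ i, v i ^ 2 / π i ≤ (ℓ ^ 2) ^ k ∧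
      timeReversal M π ^ k * M ^ k
        = vecMulVec e π + ((ℓ ^ 2) ^ k / 2) • vecMulVec f f + q • vecMulVec w v := by
    intro k hk
    rcases hk.eq_or_lt with rfl | hk
    · refine ⟨π o * (1 - π o), mul_nonneg (hπ o).le (by linarith), by simpa using hκ, ?_⟩
      rw [pow_one, pow_one, pow_one, hRe, hMe]
      simp only [add_mul, mul_add, smul_mul_assoc, mul_smul_comm, vecMulVec_mul_vecMulVec_eq_smul, h_e, h_f,
        h_h, f_e, f_f, f_h, g_e, g_f, g_h, zero_smul, smul_zero, one_smul, add_zero, zero_add,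
        smul_smul]
      congr 3; ring
    · obtain ⟨k, rfl⟩ : ∃ n, k = n + 2 := ⟨k - 2, by omega⟩
      refine ⟨0, le_rfl, by rw [zero_mul]; positivity, ?_⟩
      rw [hM2, hR2]
      simp only [add_mul, mul_add, smul_mul_assoc, mul_smul_comm, vecMulVec_mul_vecMulVec_eq_smul, h_e, h_f,
        f_e, f_f, zero_smul, smul_zero, one_smul, add_zero, zero_add, smul_smul]
      congr 2; ring
  refine hasPseudoSpectralGap_of_secondEigenvalue fun k hk => ?_
  obtain ⟨q, hq, hqk, hP⟩ := hprod k hk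
  have hUV : timeReversal M π ^ k * M ^ k
      = (of fun i => ![1, f i, w i] : Matrix (Fin d) (Fin 3) ℝ) *
        (of ![π, ((ℓ ^ 2) ^ k / 2) • f, q • v] : Matrix (Fin 3) (Fin d) ℝ) := by
    rw [hP]; ext i j
    simp [mul_apply, Fin.sum_univ_three, vecMulVec_apply, e]; ring
  have v_w : v ⬝ᵥ w = ∑ i, v i ^ 2 / π i := by
    rw [dotProduct]; refine Finset.sum_congr rfl fun i _ => ?_
    simp only [w]; ring
  rw [hUV]
  refine secondEigenvalue_mul hd _ _ (κ := q * ∑ i, v i ^ 2 / π i) ?_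
    (mul_nonneg hq (Finset.sum_nonneg fun i _ => div_nonneg (sq_nonneg _) (hπ i).le)) hqk
    (pow_le_one₀ (sq_nonneg _) (pow_le_one₀ hℓ hℓ1))
  have key : ∀ a b : Fin 3, ((of ![π, ((ℓ ^ 2) ^ k / 2) • f, q • v] : Matrix (Fin 3) (Fin d) ℝ) *
      (of fun i => ![1, f i, w i] : Matrix (Fin d) (Fin 3) ℝ)) a b
      = (![π, ((ℓ ^ 2) ^ k / 2) • f, q • v] a) ⬝ᵥ (![e, f, w] b) := by
    intro a b
    rw [mul_apply, dotProduct]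
    refine Finset.sum_congr rfl fun i _ => ?_
    fin_cases b <;> simp [e]
  ext a b
  rw [key]
  fin_cases a <;> fin_cases b <;>
    simp [h_e, h_f, π_w, f_e, f_f, f_w, v_e, v_f, v_w]

/-- The lazy version of a uniform reset, twisted by a symmetric involution. -/
theorem hasPseudoSpectralGap_uniform {d : ℕ} (hd : 2 ≤ d) {M P : Matrix (Fin d) (Fin d) ℝ}
    {ℓ : ℝ} (hℓ : 0 ≤ ℓ) (hℓ1 : ℓ ≤ 1) (hPP : P * P = 1) (hPT : Pᵀ = P)
    (hP1 : ∀ i, ∑ j, P i j = 1) (hM : M = (of fun _ _ => (1 - ℓ) / d) + ℓ • P) :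
    HasPseudoSpectralGap M (fun _ => 1 / d) (1 - ℓ ^ 2) := by
  have hd0 : (d : ℝ) ≠ 0 := by positivity
  set J : Matrix (Fin d) (Fin d) ℝ := of fun _ _ => 1 / d
  have hMJ : M = (1 - ℓ) • J + ℓ • P := by
    rw [hM]; ext i j; simp [J]; ring
  have hJJ : J * J = J := by
    ext i j; simp [J, mul_apply]; field_simp
  have hPJ : P * J = J := by
    ext i j; simp [J, mul_apply, ← Finset.sum_mul, hP1]
  have hJP : J * P = J := by
    have := congrArg transpose hPJ
    rwa [transpose_mul, hPT, show Jᵀ = J from rfl] at this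
  have hR : timeReversal M (fun _ => 1 / d) = M := by
    have hT : Mᵀ = M := by
      rw [hMJ, transpose_add, transpose_smul, transpose_smul, hPT]; rfl
    ext i j
    rw [timeReversal, of_apply, mul_div_assoc, mul_comm, div_mul_cancel₀ _ (by positivity)]
    exact congrFun (congrFun hT i) j
  -- `P * P = 1` removes `P` from the square, and `M` is its own reversal, so the gap does not
  -- depend on the involution.
  have hM2 : M * M = (1 - ℓ ^ 2) • J + (ℓ ^ 2) • (1 : Matrix (Fin d) (Fin d) ℝ) := by
    rw [hMJ]
    simp only [add_mul, mul_add, smul_mul_assoc, mul_smul_comm, hJJ, hPJ, hJP, hPP]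
    module
  have hpow : ∀ k : ℕ, 1 ≤ k → (M * M) ^ k
      = (1 - (ℓ ^ 2) ^ k) • J + ((ℓ ^ 2) ^ k) • (1 : Matrix (Fin d) (Fin d) ℝ) := by
    intro k hk
    induction k, hk using Nat.le_induction with
    | base => rw [pow_one, pow_one, hM2]
    | succ k hk ih =>
      rw [pow_succ, ih, hM2]
      simp only [add_mul, mul_add, smul_mul_assoc, mul_smul_comm, hJJ, mul_one, one_mul]
      rw [pow_succ (ℓ ^ 2) k]
      module
  refine hasPseudoSpectralGap_of_secondEigenvalue fun k hk => ?_
  have hform : timeReversal M (fun _ => 1 / d) ^ k * M ^ k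
      = vecMulVec (fun _ => 1 - (ℓ ^ 2) ^ k) (fun _ : Fin d => 1 / (d : ℝ))
        + scalar (Fin d) ((ℓ ^ 2) ^ k) := by
    rw [hR, ← (Commute.refl M).mul_pow, hpow k hk]
    ext i j
    simp [J, vecMulVec_apply, one_apply, diagonal_apply]
  rw [hform]
  refine secondEigenvalue_smul_one_add_vecMulVec hd _ _ ?_
    (pow_le_one₀ (sq_nonneg _) (pow_le_one₀ hℓ hℓ1))
  simp [dotProduct]
  field_simp

end Spectrum

/-! ### Path weights and powers of (sub)stochastic kernels. -/

section Paths

open Matrix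

/-- No stochasticity is needed, so this also evaluates the mass of killed kernels and of geometric
means of kernels. -/
theorem sum_pathProb_eq {d : ℕ} (K : Matrix (Fin d) (Fin d) ℝ) (n : ℕ) (μ : Fin d → ℝ) :
    ∑ x : Fin (n + 1) → Fin d, pathProb K μ x = ∑ i, μ i * (K ^ n *ᵥ fun _ => 1) i := by
  induction n generalizing μ with
  | zero =>
    simp only [pathProb, Finset.univ_eq_empty, Finset.prod_empty, mul_one, pow_zero, one_mulVec]
    exact Fintype.sum_equiv (Equiv.funUnique (Fin 1) (Fin d)) _ _ fun x => rfl
  | succ n ih =>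
    rw [← (Fin.consEquiv fun _ : Fin (n + 2) => Fin d).sum_comp, Fintype.sum_prod_type,
      Finset.sum_comm]
    have h : ∀ y : Fin (n + 1) → Fin d,
        ∑ i, pathProb K μ (Fin.consEquiv (fun _ : Fin (n + 2) => Fin d) (i, y))
          = pathProb K (μ ᵥ* K) y := by
      intro y
      simp only [pathProb, Fin.consEquiv, Equiv.coe_fn_mk, Fin.prod_univ_succ, vecMul, dotProduct,
        Finset.sum_mul]
      refine Finset.sum_congr rfl fun i _ => ?_
      simp [← mul_assoc]
    rw [Finset.sum_congr rfl fun y _ => h y, ih, pow_succ', ← mulVec_mulVec]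
    exact (dotProduct_mulVec μ K _).symm

theorem sum_pathProb_single {d : ℕ} (K : Matrix (Fin d) (Fin d) ℝ) (n : ℕ) (a : Fin d) :
    ∑ x : Fin (n + 1) → Fin d, pathProb K (Pi.single a 1) x = (K ^ n *ᵥ fun _ => 1) a := by
  rw [sum_pathProb_eq, Finset.sum_eq_single a] <;> simp +contextual

theorem sum_pathProb_eq_one {d : ℕ} {K : Matrix (Fin d) (Fin d) ℝ} (hK : ∀ i, ∑ j, K i j = 1)
    (n : ℕ) (a : Fin d) : ∑ x : Fin (n + 1) → Fin d, pathProb K (Pi.single a 1) x = 1 := by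
  rw [sum_pathProb_single]
  suffices h : (K ^ n *ᵥ fun _ => (1 : ℝ)) = fun _ => 1 by rw [h]
  induction n with
  | zero => simp
  | succ n ih =>
    rw [pow_succ', ← mulVec_mulVec, ih]
    ext i; simp [mulVec, dotProduct, hK]

theorem pathProb_nonneg {d : ℕ} {K : Matrix (Fin d) (Fin d) ℝ} (hK : ∀ i j, 0 ≤ K i j) {n : ℕ}
    (a : Fin d) (x : Fin (n + 1) → Fin d) : 0 ≤ pathProb K (Pi.single a 1) x := by
  refine mul_nonneg ?_ (Finset.prod_nonneg fun t _ => hK _ _)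
  by_cases h : x 0 = a
  · rw [h, Pi.single_eq_same]; norm_num
  · rw [Pi.single_eq_of_ne h]

/-- A geometric mean of path weights is the path weight of the geometric mean. -/
theorem sqrt_pathProb_mul {d : ℕ} {K K' : Matrix (Fin d) (Fin d) ℝ} (hK : ∀ i j, 0 ≤ K i j)
    (hK' : ∀ i j, 0 ≤ K' i j) {n : ℕ} (a : Fin d) (x : Fin (n + 1) → Fin d) :
    √(pathProb K (Pi.single a 1) x * pathProb K' (Pi.single a 1) x)
      = pathProb (of fun i j => √(K i j * K' i j)) (Pi.single a 1) x := by
  by_cases h : x 0 = a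
  · simp only [pathProb, h, Pi.single_eq_same, one_mul, of_apply]
    rw [← Finset.prod_mul_distrib]
    refine (Real.sqrt_eq_iff_mul_self_eq (Finset.prod_nonneg fun t _ => mul_nonneg (hK _ _)
      (hK' _ _)) (Finset.prod_nonneg fun t _ => Real.sqrt_nonneg _)).2 ?_
    rw [← Finset.prod_mul_distrib]
    exact Finset.prod_congr rfl fun t _ => (Real.mul_self_sqrt (mul_nonneg (hK _ _) (hK' _ _))).symm
  · simp [pathProb, Pi.single_eq_of_ne h]

/-- A kernel that only loses mass `η` at the state `o`, which is entered with probability at most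
`p`, keeps mass `1 - n p η - η` over `n` steps, and `1 - n p η` when it does not start at `o`. -/
theorem one_sub_le_pow_mulVec_one {d : ℕ} {K : Matrix (Fin d) (Fin d) ℝ} {o : Fin d} {p η : ℝ}
    (hp : 0 ≤ p) (hη : 0 ≤ η) (hK : ∀ i j, 0 ≤ K i j) (hKp : ∀ i, K i o ≤ p)
    (hK1 : ∀ i, i ≠ o → ∑ j, K i j = 1) (hKo : 1 - η ≤ ∑ j, K o j) (hKo1 : ∑ j, K o j ≤ 1)
    (n : ℕ) (i : Fin d) :
    1 - n * (p * η) - (if i = o then η else 0) ≤ (K ^ n *ᵥ fun _ => 1) i := by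
  induction n generalizing i with
  | zero => simp; split_ifs <;> linarith
  | succ n ih =>
    rw [pow_succ', ← mulVec_mulVec]
    have h1 : ∑ j, K i j * (1 - n * (p * η) - (if j = o then η else 0))
        ≤ (K *ᵥ (K ^ n *ᵥ fun _ => 1)) i :=
      Finset.sum_le_sum fun j _ => mul_le_mul_of_nonneg_left (ih j) (hK i j)
    refine le_trans ?_ h1
    have h2 : ∑ j, K i j * (1 - n * (p * η) - (if j = o then η else 0))
        = (∑ j, K i j) * (1 - n * (p * η)) - K i o * η := by
      simp only [mul_sub, Finset.sum_sub_distrib, Finset.sum_mul]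
      simp
    rw [h2]
    have h3 := mul_le_mul_of_nonneg_right (hKp i) hη
    have h4 : (0 : ℝ) ≤ n * (p * η) := by positivity
    push_cast
    by_cases hi : i = o
    · subst hi
      rw [if_pos rfl]
      nlinarith
    · rw [if_neg hi, hK1 i hi]
      nlinarith

end Paths

/-! ### From randomized learners to finite decoders. -/

section Learning

/-- The law of a decoded output of the learner. -/
def decodeLaw {d : ℕ} {β : Type*} (L : Learner d) (ψ : (Fin d → Fin d → ℝ) → β) {n : ℕ}
    (x : Fin (n + 1) → Fin d) (b : β) : ℝ :=
  (L n x : Measure (Fin d → Fin d → ℝ)).real (ψ ⁻¹' {b})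

theorem decodeLaw_nonneg {d : ℕ} {β : Type*} (L : Learner d) (ψ : (Fin d → Fin d → ℝ) → β)
    {n : ℕ} (x : Fin (n + 1) → Fin d) (b : β) : 0 ≤ decodeLaw L ψ x b :=
  measureReal_nonneg

theorem sum_decodeLaw {d : ℕ} {β : Type*} [Fintype β] [MeasurableSpace β]
    [MeasurableSingletonClass β] (L : Learner d) {ψ : (Fin d → Fin d → ℝ) → β}
    (hψ : Measurable ψ) {n : ℕ} (x : Fin (n + 1) → Fin d) (s : Finset β) :
    ∑ b ∈ s, decodeLaw L ψ x b
      = (L n x : Measure (Fin d → Fin d → ℝ)).real (ψ ⁻¹' s) := by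
  have := measureReal_biUnion_finset (μ := (L n x : Measure (Fin d → Fin d → ℝ))) (s := s)
    (f := fun b => ψ ⁻¹' {b})
    (fun b _ c _ hbc => Disjoint.preimage _ (by simpa using hbc))
    (fun b _ => hψ (measurableSet_singleton b))
  simp only [decodeLaw]
  rw [← this]
  congr 1
  ext A; simp

theorem sum_univ_decodeLaw {d : ℕ} {β : Type*} [Fintype β] [MeasurableSpace β]
    [MeasurableSingletonClass β] (L : Learner d) {ψ : (Fin d → Fin d → ℝ) → β}
    (hψ : Measurable ψ) {n : ℕ} (x : Fin (n + 1) → Fin d) : ∑ b, decodeLaw L ψ x b = 1 := by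
  rw [sum_decodeLaw L hψ]; simp

theorem successProb_le {d : ℕ} {β : Type*} [Fintype β] [MeasurableSpace β]
    [MeasurableSingletonClass β] (L : Learner d) {ψ : (Fin d → Fin d → ℝ) → β}
    (hψ : Measurable ψ) {n : ℕ} {ε : ℝ} {M : Matrix (Fin d) (Fin d) ℝ} (hM : ∀ i j, 0 ≤ M i j)
    (a : Fin d) (s : Finset β) (hs : ∀ A, tvNorm (M - Matrix.of A) < ε → ψ A ∈ s) :
    successProb L ε M (Pi.single a 1) n ≤
      ∑ x : Fin (n + 1) → Fin d, pathProb M (Pi.single a 1) x * ∑ b ∈ s, decodeLaw L ψ x b := by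
  refine Finset.sum_le_sum fun x _ => mul_le_mul_of_nonneg_left ?_ (pathProb_nonneg hM a x)
  rw [sum_decodeLaw L hψ]
  exact measureReal_mono fun A hA => hs A hA

theorem measurable_decide_lt {d m : ℕ} (r s : Fin m → Fin d) (c : ℝ) :
    Measurable fun (A : Fin d → Fin d → ℝ) (i : Fin m) => decide (A (r i) (s i) < c) := by
  refine measurable_pi_lambda _ fun i => measurable_to_bool ?_
  have : (fun A : Fin d → Fin d → ℝ => decide (A (r i) (s i) < c)) ⁻¹' {true}
      = (fun A : Fin d → Fin d → ℝ => A (r i) (s i)) ⁻¹' Set.Iio c := by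
    ext A; simp
  rw [this]
  exact ((measurable_pi_apply (s i)).comp (measurable_pi_apply (r i))) measurableSet_Iio

theorem row_sum_le_tvNorm {d : ℕ} (A : Matrix (Fin d) (Fin d) ℝ) (i : Fin d) :
    ∑ j, |A i j| ≤ tvNorm A :=
  le_ciSup (f := fun i => ∑ j, |A i j|) (Set.finite_range _).bddAbove i

/-- A single length suffices: failure on a trajectory of length `⌊B⌋₊ + 1 > B` pushes `m₀` above
`B`. This is why `τ` may depend on `n` in the hypothesis. -/
theorem exists_le_sampleComplexity {d : ℕ} {T : Type*} {ε B : ℝ} {L : Learner d}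
    {m₀ : Matrix (Fin d) (Fin d) ℝ → (Fin d → ℝ) → ℕ∞} (hL : IsLearner ε (1 / 10) L m₀)
    {M : T → Matrix (Fin d) (Fin d) ℝ} {μ : Fin d → ℝ} (hM : ∀ τ, IsErgodicChain (M τ))
    (hμ : μ ∈ stdSimplex ℝ (Fin d)) (hB : 0 ≤ B)
    (h : ∀ n : ℕ, (n : ℝ) ≤ B → ∃ τ, successProb L ε (M τ) μ n < 9 / 10) :
    ∃ τ, ENNReal.ofReal B ≤ (m₀ (M τ) μ : ℝ≥0∞) := by
  obtain ⟨τ, hτ⟩ := h ⌊B⌋₊ (Nat.floor_le hB)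
  refine ⟨τ, ?_⟩
  have h1 : ((⌊B⌋₊ + 1 : ℕ) : ℕ∞) ≤ m₀ (M τ) μ := by
    by_contra hlt
    have := hL (M τ) μ (hM τ) hμ ⌊B⌋₊ (not_le.1 hlt).le
    linarith
  have h2 : ((⌊B⌋₊ + 1 : ℕ) : ℝ≥0∞) ≤ (m₀ (M τ) μ : ℝ≥0∞) := by
    exact_mod_cast h1
  refine le_trans ?_ h2
  rw [← ENNReal.ofReal_natCast]
  refine ENNReal.ofReal_le_ofReal ?_
  push_cast
  exact (Nat.lt_floor_add_one B).le

end Learning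

/-! ### Decoding bits: Le Cam, Assouad, unseen bits, second moments. -/

section Bits

/-- Flip one bit. -/
def flipBit {m : ℕ} (i : Fin m) (τ : Fin m → Bool) : Fin m → Bool :=
  Function.update τ i (!τ i)

theorem flipBit_involutive {m : ℕ} (i : Fin m) : Function.Involutive (flipBit i) := by
  intro τ
  ext j
  by_cases h : j = i
  · subst h; simp [flipBit]
  · simp [flipBit, h]

theorem flipBit_same {m : ℕ} (i : Fin m) (τ : Fin m → Bool) : flipBit i τ i = !τ i := by
  simp [flipBit]

theorem flipBit_of_ne {m : ℕ} {i j : Fin m} (h : j ≠ i) (τ : Fin m → Bool) :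
    flipBit i τ j = τ j := by
  simp [flipBit, h]

theorem sum_flipBit {m : ℕ} (i : Fin m) (F : (Fin m → Bool) → ℝ) :
    ∑ τ, F τ = 1 / 2 * ∑ τ, (F τ + F (flipBit i τ)) := by
  have h : ∑ τ, F (flipBit i τ) = ∑ τ, F τ := Equiv.sum_comp (flipBit_involutive i).toPerm F
  rw [Finset.sum_add_distrib, h]
  ring

/-- Le Cam's two point bound. -/
theorem three_quarters_le_sum_error {X : Type*} [Fintype X] {P Q a b : X → ℝ}
    (hP : ∀ x, 0 ≤ P x) (hQ : ∀ x, 0 ≤ Q x) (hP1 : ∑ x, P x = 1) (hQ1 : ∑ x, Q x = 1)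
    (ha : ∀ x, 0 ≤ a x) (hb : ∀ x, 0 ≤ b x) (hab : ∀ x, a x + b x = 1)
    (hBC : 31 / 32 ≤ ∑ x, √(P x * Q x)) : 3 / 4 ≤ ∑ x, P x * a x + ∑ x, Q x * b x := by
  set B := ∑ x, √(P x * Q x)
  have hs : ∀ x, √(P x * Q x) = √(P x) * √(Q x) := fun x => Real.sqrt_mul (hP x) _
  have h1 : ∑ x, (√(P x) - √(Q x)) ^ 2 = 2 - 2 * B := by
    have : ∀ x, (√(P x) - √(Q x)) ^ 2 = P x + Q x - 2 * √(P x * Q x) := fun x => by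
      rw [hs, sub_sq, Real.sq_sqrt (hP x), Real.sq_sqrt (hQ x)]; ring
    rw [Finset.sum_congr rfl fun x _ => this x, Finset.sum_sub_distrib, Finset.sum_add_distrib,
      hP1, hQ1, ← Finset.mul_sum]
    ring
  have h2 : ∑ x, (√(P x) + √(Q x)) ^ 2 = 2 + 2 * B := by
    have : ∀ x, (√(P x) + √(Q x)) ^ 2 = P x + Q x + 2 * √(P x * Q x) := fun x => by
      rw [hs, add_sq, Real.sq_sqrt (hP x), Real.sq_sqrt (hQ x)]; ring
    rw [Finset.sum_congr rfl fun x _ => this x, Finset.sum_add_distrib, Finset.sum_add_distrib,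
      hP1, hQ1, ← Finset.mul_sum]
    ring
  -- Cauchy–Schwarz for `P - Q = (√P - √Q)(√P + √Q)`. With `B ≥ 31/32` the right side is at most
  -- `63/256 < 1/4`, which gives `h4`.
  have h3 : (∑ x, |P x - Q x|) ^ 2 ≤ (2 - 2 * B) * (2 + 2 * B) := by
    have := Finset.sum_mul_sq_le_sq_mul_sq Finset.univ (fun x => |√(P x) - √(Q x)|)
      (fun x => √(P x) + √(Q x))
    simp only [sq_abs] at this
    rw [h1, h2] at this
    have h : ∀ x, |P x - Q x| = |√(P x) - √(Q x)| * (√(P x) + √(Q x)) := fun x => by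
      rw [← abs_of_nonneg (add_nonneg (Real.sqrt_nonneg (P x)) (Real.sqrt_nonneg (Q x))),
        ← abs_mul]
      congr 1
      linear_combination -Real.sq_sqrt (hP x) + Real.sq_sqrt (hQ x)
    rwa [Finset.sum_congr rfl fun x _ => h x]
  have h4 : ∑ x, |P x - Q x| ≤ 1 / 2 := by
    refine abs_le_of_sq_le_sq' ?_ (by norm_num) |>.2
    nlinarith
  have h5 : ∑ x, (P x + Q x - |P x - Q x|) / 2 ≤ ∑ x, (P x * a x + Q x * b x) := by
    refine Finset.sum_le_sum fun x _ => ?_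
    have hb' : b x = 1 - a x := by linarith [hab x]
    have hax : a x ≤ 1 := by linarith [hab x, hb x]
    rw [hb']
    rcases abs_cases (P x - Q x) with ⟨h, _⟩ | ⟨h, _⟩ <;> rw [h] <;> nlinarith [ha x]
  rw [← Finset.sum_div, Finset.sum_sub_distrib, Finset.sum_add_distrib, Finset.sum_add_distrib,
    hP1, hQ1] at h5
  linarith

/-- Assouad's bound for the number of wrongly decoded bits. -/
theorem assouad {m : ℕ} {X : Type*} [Fintype X] {P : (Fin m → Bool) → X → ℝ}
    {q : X → (Fin m → Bool) → ℝ} (hP : ∀ τ x, 0 ≤ P τ x) (hP1 : ∀ τ, ∑ x, P τ x = 1)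
    (hq : ∀ x b, 0 ≤ q x b) (hq1 : ∀ x, ∑ b, q x b = 1)
    (hBC : ∀ i τ, 31 / 32 ≤ ∑ x, √(P τ x * P (flipBit i τ) x)) :
    (2 : ℝ) ^ m * (3 / 8 * m) ≤
      ∑ τ, ∑ x, P τ x * ∑ b, q x b * ∑ i, if b i = τ i then 0 else 1 := by
  have h1 : ∀ τ, ∑ x, P τ x * ∑ b, q x b * ∑ i, (if b i = τ i then (0 : ℝ) else 1)
      = ∑ i, ∑ x, P τ x * ∑ b, q x b * (if b i = τ i then 0 else 1) := by
    intro τ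
    rw [Finset.sum_comm]
    refine Finset.sum_congr rfl fun x _ => ?_
    rw [← Finset.mul_sum, Finset.sum_comm]
    simp only [Finset.mul_sum]
  rw [Finset.sum_congr rfl fun τ _ => h1 τ, Finset.sum_comm]
  have h2 : ∀ i : Fin m, (2 : ℝ) ^ m * (3 / 8) ≤
      ∑ τ, ∑ x, P τ x * ∑ b, q x b * (if b i = τ i then 0 else 1) := by
    intro i
    -- Pairing each `τ` with its flip, the two errors at bit `i` sum to at least `3/4`, an average
    -- of `3/8`.
    rw [sum_flipBit i]
    have h3 : ∀ τ : Fin m → Bool, 3 / 4 ≤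
        ∑ x, P τ x * ∑ b, q x b * (if b i = τ i then 0 else 1) +
        ∑ x, P (flipBit i τ) x * ∑ b, q x b * (if b i = flipBit i τ i then 0 else 1) := by
      intro τ
      refine three_quarters_le_sum_error (hP _) (hP _) (hP1 _) (hP1 _) ?_ ?_ ?_ (hBC i τ)
      · exact fun x => Finset.sum_nonneg fun b _ => mul_nonneg (hq x b) (by split_ifs <;> simp)
      · exact fun x => Finset.sum_nonneg fun b _ => mul_nonneg (hq x b) (by split_ifs <;> simp)
      · intro x
        rw [← Finset.sum_add_distrib]
        refine (Finset.sum_congr rfl fun b _ => ?_).trans (hq1 x)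
        rw [flipBit_same]
        cases b i <;> cases τ i <;> simp
    have h4 := Finset.sum_le_sum fun τ (_ : τ ∈ Finset.univ) => h3 τ
    simp only [Finset.sum_const, Finset.card_univ, Fintype.card_pi, Fintype.card_bool,
      Finset.prod_const, Fintype.card_fin, nsmul_eq_mul] at h4
    push_cast at h4
    linarith
  have h5 := Finset.sum_le_sum fun i (_ : i ∈ Finset.univ) => h2 i
  simp only [Finset.sum_const, Finset.card_univ, Fintype.card_fin, nsmul_eq_mul] at h5
  linarith

/-- If outputs counted as successes have at most `3m/20` wrong bits, some parameter has success
probability below `9/10`. -/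
theorem exists_success_lt_of_hamming {m : ℕ} (hm : 0 < m) {X : Type*} [Fintype X]
    {P : (Fin m → Bool) → X → ℝ} {q : X → (Fin m → Bool) → ℝ} (hP : ∀ τ x, 0 ≤ P τ x)
    (hP1 : ∀ τ, ∑ x, P τ x = 1) (hq : ∀ x b, 0 ≤ q x b) (hq1 : ∀ x, ∑ b, q x b = 1)
    (hBC : ∀ i τ, 31 / 32 ≤ ∑ x, √(P τ x * P (flipBit i τ) x)) :
    ∃ τ, ∑ x, P τ x * ∑ b with (∑ i, if b i = τ i then (0 : ℝ) else 1) ≤ 3 / 20 * m, q x b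
      < 9 / 10 := by
  by_contra! hcon
  have h1 := assouad hP hP1 hq hq1 hBC
  have hm' : (0 : ℝ) < m := by exact_mod_cast hm
  -- A success has at most `3m/20` wrong bits and a failure, of probability at most `1/10`, at most
  -- `m`. The expectation is thus at most `m/4`, below Assouad's `3m/8`.
  have h2 : ∀ τ, ∑ x, P τ x * ∑ b, q x b * ∑ i, (if b i = τ i then (0 : ℝ) else 1)
      ≤ 1 / 4 * m := by
    intro τ
    have h3 : ∀ x, ∑ b, q x b * ∑ i, (if b i = τ i then (0 : ℝ) else 1) ≤ 3 / 20 * m + m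
        - m * ∑ b with (∑ i, if b i = τ i then (0 : ℝ) else 1) ≤ 3 / 20 * m, q x b := by
      intro x
      rw [Finset.sum_filter, Finset.mul_sum]
      have : (3 / 20 * m + m : ℝ) = ∑ b, q x b * (3 / 20 * m + m) := by
        rw [← Finset.sum_mul, hq1, one_mul]
      rw [this, ← Finset.sum_sub_distrib]
      refine Finset.sum_le_sum fun b _ => ?_
      have hle : ∑ i, (if b i = τ i then (0 : ℝ) else 1) ≤ m := by
        calc _ ≤ ∑ _i : Fin m, (1 : ℝ) := Finset.sum_le_sum fun i _ => by split_ifs <;> simp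
          _ = m := by simp
      split_ifs with h
      · have := mul_le_mul_of_nonneg_left h (hq x b)
        linarith
      · have := mul_le_mul_of_nonneg_left hle (hq x b)
        have := mul_nonneg (hq x b) hm'.le
        linarith
    have h4 := Finset.sum_le_sum fun x (_ : x ∈ Finset.univ) =>
      mul_le_mul_of_nonneg_left (h3 x) (hP τ x)
    refine h4.trans ?_
    have h5 := hcon τ
    simp only [mul_sub, Finset.sum_sub_distrib, ← Finset.sum_mul, hP1]
    simp only [mul_left_comm (P τ _) (m : ℝ), ← Finset.mul_sum]
    nlinarith
  have h6 := Finset.sum_le_sum fun τ (_ : τ ∈ Finset.univ) => h2 τ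
  simp only [Finset.sum_const, Finset.card_univ, Fintype.card_pi, Fintype.card_bool,
    Finset.prod_const, Fintype.card_fin, nsmul_eq_mul] at h6
  push_cast at h6
  have h7 : (0 : ℝ) < 2 ^ m * m := by positivity
  nlinarith

/-- If with probability at least `1/2` some bit does not influence the observation, the bits
cannot be decoded with probability `9/10`. -/
theorem exists_success_lt_of_unseen {m : ℕ} {X : Type*} [Fintype X]
    {P : (Fin m → Bool) → X → ℝ} {q : X → (Fin m → Bool) → ℝ} (hP : ∀ τ x, 0 ≤ P τ x)
    (hP1 : ∀ τ, ∑ x, P τ x = 1) (hq : ∀ x b, 0 ≤ q x b) (hq1 : ∀ x, ∑ b, q x b = 1)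
    (U : X → Finset (Fin m)) (hU : ∀ x, ∀ i ∈ U x, ∀ τ, P (flipBit i τ) x = P τ x)
    (hPU : ∀ τ, 1 / 2 ≤ ∑ x with (U x).Nonempty, P τ x) :
    ∃ τ, ∑ x, P τ x * q x τ < 9 / 10 := by
  by_contra! hcon
  have hq_le : ∀ x b, q x b ≤ 1 := fun x b =>
    hq1 x ▸ Finset.single_le_sum (fun b _ => hq x b) (Finset.mem_univ b)
  have h1 : ∀ x, ∑ τ, P τ x * q x τ ≤
      ∑ τ, (P τ x - 1 / 2 * if (U x).Nonempty then P τ x else 0) := by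
    intro x
    by_cases hx : (U x).Nonempty
    · obtain ⟨i, hi⟩ := hx
      have hx : (U x).Nonempty := ⟨i, hi⟩
      simp only [if_pos hx]
      rw [sum_flipBit i, Finset.mul_sum]
      refine Finset.sum_le_sum fun τ _ => ?_
      rw [hU x i hi τ, ← mul_add]
      have hne : τ ≠ flipBit i τ := fun h => by
        have := congrFun h i
        rw [flipBit_same] at this
        cases h : τ i <;> simp [h] at this
      have h2 : q x τ + q x (flipBit i τ) ≤ 1 := by
        rw [← hq1 x, ← Finset.sum_pair hne]
        exact Finset.sum_le_sum_of_subset_of_nonneg (Finset.subset_univ _) fun b _ _ => hq x b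
      nlinarith [hP τ x]
    · simp only [if_neg hx]
      refine Finset.sum_le_sum fun τ _ => ?_
      nlinarith [hP τ x, hq_le x τ]
  -- With `τ` uniform, an unseen bit is guessed with success at most `1/2`, so the mean success is
  -- at most `1 - 1/2 · 1/2`.
  have h2 : ∑ τ, ∑ x, P τ x * q x τ ≤ ∑ _τ : Fin m → Bool, (3 / 4 : ℝ) := by
    rw [Finset.sum_comm]
    refine (Finset.sum_le_sum fun x _ => h1 x).trans ?_
    rw [Finset.sum_comm]
    refine Finset.sum_le_sum fun τ _ => ?_
    rw [Finset.sum_sub_distrib, hP1, ← Finset.mul_sum, ← Finset.sum_filter]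
    linarith [hPU τ]
  have h3 := (Finset.sum_le_sum fun τ (_ : τ ∈ Finset.univ) => hcon τ).trans h2
  simp only [Finset.sum_const, Finset.card_univ, Fintype.card_pi, Fintype.card_bool,
    Finset.prod_const, Fintype.card_fin, nsmul_eq_mul] at h3
  push_cast at h3
  have h7 : (0 : ℝ) < 2 ^ m := by positivity
  nlinarith

/-- Second moment bound: nonnegative weights `P` of total mass `1` for which events `E i` are
pairwise negatively correlated with equal probabilities `r`. -/
theorem half_le_sum_of_negative_correlation {X ι : Type*} [Fintype X] [DecidableEq ι]
    {P : X → ℝ} (hP : ∀ x, 0 ≤ P x) (U : X → Finset ι) (S : Finset ι) (hUS : ∀ x, U x ⊆ S) {r : ℝ}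
    (hr : 1 ≤ S.card * r) (h1 : ∀ i ∈ S, ∑ x with i ∈ U x, P x = r)
    (h2 : ∀ i ∈ S, ∀ j ∈ S, i ≠ j → ∑ x with i ∈ U x ∧ j ∈ U x, P x ≤ r ^ 2) :
    1 / 2 ≤ ∑ x with (U x).Nonempty, P x := by
  have hcard : ∀ x, ((U x).card : ℝ) = ∑ i ∈ S, if i ∈ U x then 1 else 0 := by
    intro x
    rw [Finset.sum_ite_mem, Finset.inter_eq_right.2 (hUS x)]; simp
  have hA : ∑ x, P x * (U x).card = S.card * r := by
    simp only [hcard, Finset.mul_sum]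
    rw [Finset.sum_comm, ← nsmul_eq_mul, ← Finset.sum_const]
    refine Finset.sum_congr rfl fun i hi => ?_
    rw [← h1 i hi, Finset.sum_filter]
    simp
  have hB : ∑ x, P x * (U x).card ^ 2 ≤ S.card * r + (S.card * r) ^ 2 := by
    have : ∀ x, P x * ((U x).card : ℝ) ^ 2
        = ∑ i ∈ S, ∑ j ∈ S, if i ∈ U x ∧ j ∈ U x then P x else 0 := by
      intro x
      rw [hcard, sq, Finset.sum_mul_sum, Finset.mul_sum]
      refine Finset.sum_congr rfl fun i _ => ?_
      rw [Finset.mul_sum]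
      refine Finset.sum_congr rfl fun j _ => ?_
      by_cases hi : i ∈ U x <;> by_cases hj : j ∈ U x <;> simp [hi, hj]
    rw [Finset.sum_congr rfl fun x _ => this x, Finset.sum_comm]
    have h3 : ∀ i ∈ S, ∑ x, ∑ j ∈ S, (if i ∈ U x ∧ j ∈ U x then P x else 0)
        ≤ r + S.card * r ^ 2 := by
      intro i hi
      rw [Finset.sum_comm]
      have h4 : ∀ j ∈ S, ∑ x, (if i ∈ U x ∧ j ∈ U x then P x else 0)
          ≤ (if i = j then r else 0) + r ^ 2 := by
        intro j hj
        rw [← Finset.sum_filter]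
        split_ifs with hij
        · subst hij
          simp only [and_self]
          rw [h1 i hi]
          nlinarith [sq_nonneg r]
        · rw [zero_add]; exact h2 i hi j hj hij
      refine (Finset.sum_le_sum h4).trans ?_
      rw [Finset.sum_add_distrib, Finset.sum_ite_eq, if_pos hi, Finset.sum_const, nsmul_eq_mul]
    refine (Finset.sum_le_sum h3).trans ?_
    rw [Finset.sum_const, nsmul_eq_mul]
    nlinarith
  -- Cauchy–Schwarz on the event that `U` is nonempty. With `A = S.card * r` it yields `A ^ 2 ≤ p (A
  -- + A ^ 2)`, and `A ≥ 1` gives `p ≥ 1/2`.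
  have hC : (∑ x, P x * (U x).card) ^ 2 ≤
      (∑ x with (U x).Nonempty, P x) * ∑ x, P x * (U x).card ^ 2 := by
    have hcs := Finset.sum_mul_sq_le_sq_mul_sq (Finset.univ.filter fun x => (U x).Nonempty)
      (fun x => √(P x)) (fun x => √(P x) * (U x).card)
    have e1 : ∑ x with (U x).Nonempty, √(P x) * (√(P x) * (U x).card)
        = ∑ x, P x * (U x).card := by
      rw [Finset.sum_filter]
      refine Finset.sum_congr rfl fun x _ => ?_
      split_ifs with h
      · rw [← mul_assoc, Real.mul_self_sqrt (hP x)]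
      · rw [Finset.not_nonempty_iff_eq_empty.1 h]; simp
    have e2 : ∑ x with (U x).Nonempty, √(P x) ^ 2 = ∑ x with (U x).Nonempty, P x :=
      Finset.sum_congr rfl fun x _ => Real.sq_sqrt (hP x)
    have e3 : ∑ x with (U x).Nonempty, (√(P x) * (U x).card) ^ 2
        ≤ ∑ x, P x * (U x).card ^ 2 := by
      rw [Finset.sum_filter]
      refine Finset.sum_le_sum fun x _ => ?_
      rw [mul_pow, Real.sq_sqrt (hP x)]
      split_ifs
      · rfl
      · exact mul_nonneg (hP x) (sq_nonneg _)
    rw [e1, e2] at hcs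
    exact hcs.trans (mul_le_mul_of_nonneg_left e3 (Finset.sum_nonneg fun x _ => hP x))
  rw [hA] at hC
  set A := (S.card : ℝ) * r
  set p := ∑ x with (U x).Nonempty, P x
  have hp : 0 ≤ p := Finset.sum_nonneg fun x _ => hP x
  have h5 := hC.trans (mul_le_mul_of_nonneg_left hB hp)
  by_contra! hlt
  nlinarith [mul_pos (show 0 < A by linarith) (show 0 < A + 1 by linarith)]

end Bits

/-! ### The reset chain and the coupon collector bound. -/

section ResetChain

open Matrix

variable {d N : ℕ} (e : Fin d ≃ Fin N × Bool)

/-- The involution that swaps the two states of each pair selected by `τ`. -/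
def swapPairs (τ : Fin N → Bool) (i : Fin d) : Fin d :=
  e.symm ((e i).1, xor (e i).2 (τ (e i).1))

theorem swapPairs_fst (τ : Fin N → Bool) (i : Fin d) : (e (swapPairs e τ i)).1 = (e i).1 := by
  simp [swapPairs]

theorem swapPairs_involutive (τ : Fin N → Bool) : Function.Involutive (swapPairs e τ) := by
  intro i
  simp [swapPairs]

theorem eq_swapPairs_iff (τ : Fin N → Bool) (i j : Fin d) :
    j = swapPairs e τ i ↔ i = swapPairs e τ j :=
  ⟨fun h => by rw [h, swapPairs_involutive], fun h => by rw [h, swapPairs_involutive]⟩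

/-- With probability `1 - ℓ` the chain moves to a uniform state, otherwise it applies the
involution selected by `τ`. -/
noncomputable def resetChain (ℓ : ℝ) (τ : Fin N → Bool) : Matrix (Fin d) (Fin d) ℝ :=
  of fun i j => (1 - ℓ) / d + ℓ * if j = swapPairs e τ i then 1 else 0

variable {e} {ℓ : ℝ} {τ : Fin N → Bool}

theorem resetChain_pos (hd : 0 < d) (hℓ : 0 ≤ ℓ) (hℓ1 : ℓ < 1) (i j : Fin d) :
    0 < resetChain e ℓ τ i j := by
  have h1 : 0 < (1 - ℓ) / d := div_pos (by linarith) (by exact_mod_cast hd)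
  have h2 : 0 ≤ ℓ * (if j = swapPairs e τ i then 1 else 0 : ℝ) :=
    mul_nonneg hℓ (by split_ifs <;> simp)
  rw [resetChain, of_apply]
  linarith

theorem sum_resetChain (hd : 0 < d) (i : Fin d) : ∑ j, resetChain e ℓ τ i j = 1 := by
  have : (d : ℝ) ≠ 0 := by positivity
  simp [resetChain, Finset.sum_add_distrib]
  field_simp
  ring

theorem isErgodicChain_resetChain (hd : 0 < d) (hℓ : 0 ≤ ℓ) (hℓ1 : ℓ < 1) :
    IsErgodicChain (resetChain e ℓ τ) := by
  refine ⟨mem_rowStochastic.2 ⟨fun i j => (resetChain_pos hd hℓ hℓ1 i j).le, ?_⟩, 1, le_rfl,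
    fun i j => by rw [pow_one]; exact resetChain_pos hd hℓ hℓ1 i j⟩
  ext i
  simp [mulVec, dotProduct, sum_resetChain hd]

theorem resetChain_symm (i j : Fin d) : resetChain e ℓ τ i j = resetChain e ℓ τ j i := by
  simp only [resetChain, of_apply, eq_swapPairs_iff e τ i j]

theorem isStationary_resetChain (hd : 0 < d) :
    IsStationary (resetChain e ℓ τ) fun _ => 1 / (d : ℝ) := by
  refine ⟨⟨fun _ => by positivity, ?_⟩, ?_⟩
  · have : (d : ℝ) ≠ 0 := by positivity
    simp [this]
  · ext j
    simp only [vecMul, dotProduct, resetChain_symm _ j, ← Finset.mul_sum, sum_resetChain hd]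
    simp

theorem hasPseudoSpectralGap_resetChain (hd : 2 ≤ d) (hℓ : 0 ≤ ℓ) (hℓ1 : ℓ ≤ 1) :
    HasPseudoSpectralGap (resetChain e ℓ τ) (fun _ => 1 / (d : ℝ)) (1 - ℓ ^ 2) := by
  refine hasPseudoSpectralGap_uniform hd hℓ hℓ1
    (P := of fun i j => if j = swapPairs e τ i then 1 else 0) ?_ ?_ ?_ ?_
  · ext i j
    simp only [mul_apply, of_apply, ite_mul, one_mul, zero_mul, Finset.sum_ite_eq',
      Finset.mem_univ, if_true, swapPairs_involutive e τ i, one_apply, eq_comm]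
  · ext i j
    simp only [transpose_apply, of_apply, eq_swapPairs_iff e τ j i]
  · intro i; simp
  · ext i j; simp [resetChain]

/-- The probability to avoid a set of pairs not containing the starting point. -/
theorem sum_pathProb_resetChain_avoid (hd : 0 < d) (B : Finset (Fin N)) {a : Fin d}
    (ha : (e a).1 ∉ B) (n : ℕ) :
    ∑ x : Fin (n + 1) → Fin d with ∀ t, (e (x t)).1 ∉ B,
      pathProb (resetChain e ℓ τ) (Pi.single a 1) x = (1 - (1 - ℓ) / d * (2 * B.card)) ^ n := by
  -- The chain killed on entering `B`. The involution never leaves a pair, so only resets can kill,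
  -- and the survival probability per step is the same from every surviving state.
  set K : Matrix (Fin d) (Fin d) ℝ :=
    of fun i j => if (e j).1 ∈ B then 0 else resetChain e ℓ τ i j
  have h1 : ∀ x : Fin (n + 1) → Fin d, (if ∀ t, (e (x t)).1 ∉ B then
      pathProb (resetChain e ℓ τ) (Pi.single a 1) x else 0) = pathProb K (Pi.single a 1) x := by
    intro x
    by_cases hx : x 0 = a
    · simp only [pathProb, hx, Pi.single_eq_same, one_mul]
      split_ifs with h
      · exact Finset.prod_congr rfl fun t _ => by simp [K, h]
      · push Not at h
        obtain ⟨t, ht⟩ := h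
        have ht0 : t ≠ 0 := by rintro rfl; exact ha (hx ▸ ht)
        obtain ⟨s, rfl⟩ := Fin.exists_succ_eq.2 ht0
        refine (Finset.prod_eq_zero (Finset.mem_univ s) ?_).symm
        simp [K, ht]
    · simp [pathProb, Pi.single_eq_of_ne hx]
  rw [Finset.sum_filter, Finset.sum_congr rfl fun x _ => h1 x, sum_pathProb_single]
  have hcard : ∑ j : Fin d, (if (e j).1 ∈ B then (0 : ℝ) else 1) = d - 2 * B.card := by
    have h2 : ∑ j : Fin d, (if (e j).1 ∈ B then (1 : ℝ) else 0) = 2 * B.card := by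
      rw [e.sum_comp fun s => if s.1 ∈ B then (1 : ℝ) else 0, Fintype.sum_prod_type]
      have h5 : ∀ i : Fin N, ∑ _b : Bool, (if i ∈ B then (1 : ℝ) else 0)
          = 2 * if i ∈ B then 1 else 0 := fun i => by split_ifs <;> simp
      rw [Finset.sum_congr rfl fun i _ => h5 i, ← Finset.mul_sum]
      simp
    have h3 : ∀ j : Fin d, (if (e j).1 ∈ B then (0 : ℝ) else 1)
        = 1 - if (e j).1 ∈ B then 1 else 0 := fun j => by split_ifs <;> simp
    rw [Finset.sum_congr rfl fun j _ => h3 j, Finset.sum_sub_distrib, h2]; simp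
  have hrow : ∀ i, (e i).1 ∉ B → ∑ j, K i j = 1 - (1 - ℓ) / d * (2 * B.card) := by
    intro i hi
    have h4 : ∀ j, K i j = (1 - ℓ) / d * (if (e j).1 ∈ B then 0 else 1)
        + ℓ * if j = swapPairs e τ i then 1 else 0 := by
      intro j
      by_cases hj : (e j).1 ∈ B
      · have : j ≠ swapPairs e τ i := by
          rintro rfl; rw [swapPairs_fst] at hj; exact hi hj
        simp [K, hj, this]
      · simp [K, hj, resetChain]
    have : (d : ℝ) ≠ 0 := by positivity
    rw [Finset.sum_congr rfl fun j _ => h4 j, Finset.sum_add_distrib, ← Finset.mul_sum,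
      ← Finset.mul_sum, hcard]
    simp
    field_simp
    ring
  suffices h : ∀ i, (e i).1 ∉ B →
      (K ^ n *ᵥ fun _ => 1) i = (1 - (1 - ℓ) / d * (2 * B.card)) ^ n from h a ha
  clear h1
  induction n with
  | zero => intro i _; simp
  | succ n ih =>
    intro i hi
    rw [pow_succ', ← mulVec_mulVec, pow_succ']
    conv_rhs => rw [← hrow i hi, Finset.sum_mul, hrow i hi]
    change ∑ j, K i j * (K ^ n *ᵥ fun _ => 1) j = _
    refine Finset.sum_congr rfl fun j _ => ?_
    by_cases hj : (e j).1 ∈ B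
    · simp [K, hj]
    · rw [ih j hj]

theorem pathProb_resetChain_flipBit {n : ℕ} (μ : Fin d → ℝ) {x : Fin (n + 1) → Fin d} {i : Fin N}
    (hi : ∀ t, (e (x t)).1 ≠ i) :
    pathProb (resetChain e ℓ (flipBit i τ)) μ x = pathProb (resetChain e ℓ τ) μ x := by
  have h : ∀ t, swapPairs e (flipBit i τ) (x t) = swapPairs e τ (x t) := fun t => by
    rw [swapPairs, flipBit_of_ne (hi t), swapPairs]
  simp only [pathProb, resetChain, of_apply, h]

/-- Some pair other than the initial one stays unvisited with probability at least `1/2`. -/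
theorem half_le_unvisited (hd : d = 2 * N) (hN : 6 ≤ N) (hℓ : 0 ≤ ℓ) (hℓ1 : ℓ < 1)
    {γ : ℝ} (hγ : 0 < γ) (hℓγ : 1 - ℓ ≤ γ) (hγ1 : γ ≤ 1) (a : Fin d) {n : ℕ}
    (hn : (n : ℝ) ≤ 1 / 8 * (Real.log d / (γ * (1 / d)))) :
    1 / 2 ≤ ∑ x : Fin (n + 1) → Fin d with
      ((Finset.univ.erase (e a).1).filter fun i => ∀ t, (e (x t)).1 ≠ i).Nonempty,
        pathProb (resetChain e ℓ τ) (Pi.single a 1) x := by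
  have hd0 : 0 < d := by omega
  have hdR : (12 : ℝ) ≤ d := by exact_mod_cast (by omega : 12 ≤ d)
  have hdpos : (0 : ℝ) < d := by linarith
  set u : ℝ := (1 - ℓ) / d * 2 with hu
  have hu0 : 0 ≤ u := by have := sub_pos.2 hℓ1; positivity
  have hu1 : u ≤ 2 * γ / d := by
    rw [hu, div_mul_eq_mul_div, mul_comm]; gcongr
  have hu2 : u ≤ 1 / 6 := by
    refine hu1.trans ?_
    rw [div_le_iff₀ hdpos]; linarith
  refine half_le_sum_of_negative_correlation
    (fun x => pathProb_nonneg (fun i j => (resetChain_pos hd0 hℓ hℓ1 i j).le) a x) _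
    (Finset.univ.erase (e a).1) (fun x => Finset.filter_subset _ _) (r := (1 - u) ^ n) ?_ ?_ ?_
  -- The bound on `n` gives `(1 - u) ^ n ≥ 1 / √d`, and there are `d / 2 - 1 ≥ √d` pairs to be
  -- found, so at least one is missed on average.
  · have hlog : -(2 * u) ≤ Real.log (1 - u) := by
      have h := Real.one_sub_inv_le_log_of_pos (show 0 < 1 - u by linarith)
      refine le_trans ?_ h
      rw [neg_le_sub_iff_le_add, inv_le_iff_one_le_mul₀ (by linarith)]
      nlinarith
    have hlogd : 0 ≤ Real.log d := Real.log_nonneg (by linarith)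
    have h1 : -(1 / 2 * Real.log d) ≤ n * Real.log (1 - u) := by
      have h2 : (n : ℝ) * (2 * u) ≤ 1 / 2 * Real.log d := by
        calc (n : ℝ) * (2 * u)
            ≤ (1 / 8 * (Real.log d / (γ * (1 / d)))) * (2 * (2 * γ / d)) := by gcongr
          _ = 1 / 2 * Real.log d := by field_simp; ring
      have h3 := mul_le_mul_of_nonneg_left hlog (Nat.cast_nonneg (α := ℝ) n)
      linarith
    have h4 : (√d)⁻¹ ≤ (1 - u) ^ n := by
      have hs : 0 < √(d : ℝ) := Real.sqrt_pos.2 hdpos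
      rw [← Real.log_le_log_iff (by positivity) (pow_pos (by linarith) n), Real.log_inv,
        Real.log_sqrt hdpos.le, Real.log_pow]
      linarith
    have hcard : ((Finset.univ.erase (e a).1).card : ℝ) = d / 2 - 1 := by
      rw [Finset.card_erase_of_mem (Finset.mem_univ _), Finset.card_univ, Fintype.card_fin,
        Nat.cast_sub (by omega), hd]
      push_cast; ring
    rw [hcard]
    have h5 : √(d : ℝ) ≤ d / 2 - 1 := by
      rw [Real.sqrt_le_left (by linarith)]; nlinarith
    have hs : 0 < √(d : ℝ) := Real.sqrt_pos.2 hdpos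
    calc (1 : ℝ) = √d * (√d)⁻¹ := (mul_inv_cancel₀ hs.ne').symm
      _ ≤ (d / 2 - 1) * (1 - u) ^ n := by gcongr; linarith
  · intro i hi
    have := sum_pathProb_resetChain_avoid (e := e) (ℓ := ℓ) (τ := τ) hd0 {i} (a := a)
      (by simpa using (Finset.ne_of_mem_erase hi).symm) n
    simp only [Finset.card_singleton, Nat.cast_one, mul_one, Finset.mem_singleton] at this
    rw [← this]
    refine Finset.sum_congr (Finset.filter_congr fun x _ => ?_) fun _ _ => rfl
    rw [Finset.mem_filter]
    exact ⟨fun h => h.2, fun h => ⟨hi, h⟩⟩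
  · intro i hi j hj hij
    have := sum_pathProb_resetChain_avoid (e := e) (ℓ := ℓ) (τ := τ) hd0 {i, j} (a := a)
      (by simpa using ⟨(Finset.ne_of_mem_erase hi).symm, (Finset.ne_of_mem_erase hj).symm⟩) n
    rw [Finset.card_pair hij] at this
    -- Negative correlation is `1 - 2u ≤ (1 - u) ^ 2`.
    have h1 : (1 - (1 - ℓ) / d * (2 * ((2 : ℕ) : ℝ))) ^ n ≤ ((1 - u) ^ n) ^ 2 := by
      rw [← pow_mul, mul_comm n 2, pow_mul]
      have : (1 - ℓ) / d * (2 * ((2 : ℕ) : ℝ)) = 2 * u := by rw [hu]; push_cast; ring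
      rw [this]
      exact pow_le_pow_left₀ (by linarith) (by nlinarith) n
    refine le_trans (le_of_eq ?_) h1
    rw [← this]
    refine Finset.sum_congr (Finset.filter_congr fun x _ => ?_) fun _ _ => rfl
    simp only [Finset.mem_filter, hi, hj, true_and, Finset.mem_insert, Finset.mem_singleton,
      not_or, forall_and]

theorem reset_lower_bound {ε γ : ℝ} (hε1 : ε < 1 / 32) (hγ : 0 < γ)
    (hγ1 : γ < 1 / 8) (hd : d = 2 * N) (hN : 6 ≤ N) {L : Learner d}
    {m₀ : Matrix (Fin d) (Fin d) ℝ → (Fin d → ℝ) → ℕ∞} (hL : IsLearner ε (1 / 10) L m₀) :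
    ∃ (M : Matrix (Fin d) (Fin d) ℝ) (π μ : Fin d → ℝ), IsErgodicChain M ∧ IsStationary M π ∧
      HasPseudoSpectralGap M π γ ∧ minProb π = 1 / d ∧ μ ∈ stdSimplex ℝ (Fin d) ∧
      ENNReal.ofReal (1 / 8 * (Real.log d / (γ * (1 / d)))) ≤ (m₀ M μ : ℝ≥0∞) := by
  obtain ⟨e⟩ : Nonempty (Fin d ≃ Fin N × Bool) :=
    ⟨Fintype.equivOfCardEq (by simp [hd, mul_comm])⟩
  have hd0 : 0 < d := by omega
  have : NeZero d := ⟨hd0.ne'⟩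
  have hdR : (12 : ℝ) ≤ d := by exact_mod_cast (by omega : 12 ≤ d)
  set ℓ := √(1 - γ)
  have hℓ0 : 0 ≤ ℓ := Real.sqrt_nonneg _
  have hℓ2 : ℓ ^ 2 = 1 - γ := Real.sq_sqrt (by linarith)
  have hℓ1 : ℓ < 1 := by nlinarith
  have hℓ9 : 9 / 10 < ℓ := by nlinarith
  set a : Fin d := 0
  have hμ : (Pi.single a 1 : Fin d → ℝ) ∈ stdSimplex ℝ (Fin d) := single_mem_stdSimplex ℝ a
  have key : ∀ n : ℕ, (n : ℝ) ≤ 1 / 8 * (Real.log d / (γ * (1 / d))) →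
      ∃ τ, successProb L ε (resetChain e ℓ τ) (Pi.single a 1) n < 9 / 10 := by
    intro n hn
    -- The diagonal entry at one state of pair `i` is at least `ℓ > 9/10` if the pair is fixed and
    -- at most `1/10` if it is swapped, so accuracy `1/32` reveals every bit.
    set ψ : (Fin d → Fin d → ℝ) → (Fin N → Bool) := fun A i =>
      decide (A (e.symm (i, false)) (e.symm (i, false)) < 1 / 2)
    have hψ : Measurable ψ := measurable_decide_lt _ _ _
    have hdec : ∀ τ A, tvNorm (resetChain e ℓ τ - Matrix.of A) < ε → ψ A ∈ ({τ} : Finset _) := by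
      intro τ A hA
      rw [Finset.mem_singleton]
      ext i
      set j := e.symm (i, false)
      have h1 : |resetChain e ℓ τ j j - A j j| < 1 / 32 := by
        refine lt_of_le_of_lt ?_ (hA.trans hε1)
        refine le_trans ?_ (row_sum_le_tvNorm _ j)
        exact Finset.single_le_sum (f := fun l => |(resetChain e ℓ τ - Matrix.of A) j l|)
          (fun l _ => abs_nonneg _) (Finset.mem_univ j)
      rw [abs_lt] at h1
      have hq0 : 0 ≤ (1 - ℓ) / d := div_nonneg (by linarith) (by linarith)
      have hq1 : (1 - ℓ) / d ≤ 1 / 10 := by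
        rw [div_le_iff₀ (by linarith)]; linarith
      cases hi : τ i
      · have : resetChain e ℓ τ j j = (1 - ℓ) / d + ℓ := by
          simp [resetChain, swapPairs, j, hi]
        simp only [ψ, decide_eq_false_iff_not, not_lt]
        change 1 / 2 ≤ A j j
        linarith
      · have : resetChain e ℓ τ j j = (1 - ℓ) / d := by
          simp [resetChain, swapPairs, j, hi]
        simp only [ψ, decide_eq_true_eq]
        change A j j < 1 / 2
        linarith
    have hMnn : ∀ τ i j, 0 ≤ resetChain e ℓ τ i j := fun τ i j =>
      (resetChain_pos hd0 hℓ0 hℓ1 i j).le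
    obtain ⟨τ, hτ⟩ := exists_success_lt_of_unseen (X := Fin (n + 1) → Fin d)
      (P := fun τ x => pathProb (resetChain e ℓ τ) (Pi.single a 1) x)
      (q := fun x b => decodeLaw L ψ x b)
      (fun τ x => pathProb_nonneg (hMnn τ) a x)
      (fun τ => sum_pathProb_eq_one (fun i => sum_resetChain hd0 i) n a)
      (fun x b => decodeLaw_nonneg L ψ x b) (fun x => sum_univ_decodeLaw L hψ x)
      (fun x => (Finset.univ.erase (e a).1).filter fun i => ∀ t, (e (x t)).1 ≠ i)
      (fun x i hi τ => pathProb_resetChain_flipBit _ (Finset.mem_filter.1 hi).2)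
      (fun τ => half_le_unvisited hd hN hℓ0 hℓ1 hγ (by nlinarith) (by linarith) a hn)
    refine ⟨τ, lt_of_le_of_lt (successProb_le L hψ (hMnn τ) a {τ} (hdec τ)) ?_⟩
    simpa using hτ
  obtain ⟨τ, hτ⟩ := exists_le_sampleComplexity (T := Fin N → Bool) hL
    (M := fun τ => resetChain e ℓ τ) (μ := Pi.single a 1)
    (fun τ => isErgodicChain_resetChain hd0 hℓ0 hℓ1) hμ
    (B := 1 / 8 * (Real.log d / (γ * (1 / d))))
    (by have := Real.log_nonneg (show (1 : ℝ) ≤ d by linarith); positivity)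
    key
  refine ⟨resetChain e ℓ τ, fun _ => 1 / d, Pi.single a 1, isErgodicChain_resetChain hd0 hℓ0 hℓ1,
      isStationary_resetChain hd0, ?_, ?_, hμ, hτ⟩
  · have := hasPseudoSpectralGap_resetChain (e := e) (τ := τ) (by omega) hℓ0 hℓ1.le
    rwa [hℓ2, sub_sub_cancel] at this
  · simp [minProb]

end ResetChain

/-! ### The rare state chain: kernel, stationary law, affinity of rows. -/

section RareStateChain

open Matrix

/-- The states: a rare state `inl 0`, a neutral state `inl 1`, two sticky states `inl 2`, `inl 3`,
and pairs of states that carry one bit each. -/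
abbrev RareStates (m : ℕ) : Type := Fin 4 ⊕ (Fin m × Bool)

/-- The slow observable: the difference of the indicators of the sticky states. -/
def slowFun {m : ℕ} : RareStates m → ℝ := Sum.elim ![0, 0, 1, -1] fun _ => 0

/-- The row of the states that are neither rare nor sticky. -/
noncomputable def bulkRow {m : ℕ} (p ℓ : ℝ) : RareStates m → ℝ :=
  Sum.elim ![p, (1 - p - ℓ) / (2 * m + 1), ℓ / 2, ℓ / 2] fun _ => (1 - p - ℓ) / (2 * m + 1)

/-- The difference between the row of the rare state and that of the bulk. -/
noncomputable def rareShift {m : ℕ} (p ℓ β : ℝ) (τ : Fin m → Bool) : RareStates m → ℝ :=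
  Sum.elim ![0, ℓ / (2 * m + 1), -(ℓ / 2), -(ℓ / 2)]
    fun s => (ℓ + (1 - p) * β * if s.2 = τ s.1 then 1 else -1) / (2 * m + 1)

/-- The transition probabilities: a sticky state stays with additional probability `ℓ`, the rare
state has probability `p` of being entered, and its row carries the bits `τ`. -/
noncomputable def rareKernel {m : ℕ} (p ℓ β : ℝ) (τ : Fin m → Bool) (s t : RareStates m) : ℝ :=
  bulkRow p ℓ t + ℓ / 2 * slowFun s * slowFun t + if s = Sum.inl 0 then rareShift p ℓ β τ t else 0

/-- Every row enters the rare state with probability `p`, so averaging the rows gives the bulk row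
plus `p` times the shift; the sticky contributions cancel by symmetry. -/
noncomputable def rareStationary {m : ℕ} (p ℓ β : ℝ) (τ : Fin m → Bool) (s : RareStates m) : ℝ :=
  bulkRow p ℓ s + p * rareShift p ℓ β τ s

/-- The admissible range of the parameters. -/
structure RareParams (m : ℕ) (p ℓ β : ℝ) : Prop where
  m_ge : 4 ≤ m
  ℓ_gt : 9 / 10 < ℓ
  ℓ_lt : ℓ < 1
  -- This makes the bulk weight `(1 - p - ℓ) / (2m + 1)` almost `8p`, so that the rare state attains
  -- the minimum `π⋆` with room to spare.
  p_eq : p * (8 * (2 * m + 1)) = 1 - ℓ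
  β_pos : 0 < β
  β_le : β ≤ 1 / 2

variable {m : ℕ} {p ℓ β : ℝ} {τ : Fin m → Bool}

/-- The row of the rare state on the pairs. -/
theorem rareRow_pair (i : Fin m) (b : Bool) :
    bulkRow p ℓ (Sum.inr (i, b)) + rareShift p ℓ β τ (Sum.inr (i, b))
      = (1 - p) * (1 + β * if b = τ i then 1 else -1) / (2 * m + 1) := by
  simp only [bulkRow, rareShift, Sum.elim_inr]
  ring

theorem sum_slowFun : ∑ s : RareStates m, slowFun s = 0 := by
  rw [Fintype.sum_sum_type, Fin.sum_univ_four]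
  simp [slowFun]

theorem sum_slowFun_mul_rareShift :
    ∑ s : RareStates m, slowFun s * rareShift p ℓ β τ s = 0 := by
  rw [Fintype.sum_sum_type, Fin.sum_univ_four]
  simp [slowFun, rareShift]

theorem sum_slowFun_sq : ∑ s : RareStates m, slowFun s * slowFun s = 2 := by
  rw [Fintype.sum_sum_type, Fin.sum_univ_four]
  simp [slowFun]
  norm_num

theorem rareStationary_mul_slowFun (s : RareStates m) :
    rareStationary p ℓ β τ s * slowFun s = (1 - p) * ℓ / 2 * slowFun s := by
  rcases s with s | s
  · fin_cases s <;> simp [rareStationary, bulkRow, rareShift, slowFun] <;> ring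
  · simp [slowFun]

theorem rareStationary_rare : rareStationary p ℓ β τ (Sum.inl 0) = p := by
  simp [rareStationary, bulkRow, rareShift]

theorem rareKernel_rare (s : RareStates m) : rareKernel p ℓ β τ s (Sum.inl 0) = p := by
  simp [rareKernel, bulkRow, rareShift, slowFun]

/-- The decomposition required by `hasPseudoSpectralGap_of_rank_three`. -/
theorem rareKernel_eq (s t : RareStates m) : rareKernel p ℓ β τ s t = rareStationary p ℓ β τ t
    + ℓ / 2 * slowFun s * slowFun t
    + ((if s = Sum.inl 0 then 1 else 0) - p) * rareShift p ℓ β τ t := by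
  rw [rareKernel, rareStationary]
  split_ifs <;> ring

theorem sum_bulkRow : ∑ s : RareStates m, bulkRow p ℓ s = 1 := by
  have hD : (2 * m + 1 : ℝ) ≠ 0 := by positivity
  rw [Fintype.sum_sum_type, Fin.sum_univ_four]
  simp [bulkRow]
  field_simp
  ring

theorem sum_rareShift : ∑ s : RareStates m, rareShift p ℓ β τ s = 0 := by
  have hD : (2 * m + 1 : ℝ) ≠ 0 := by positivity
  rw [Fintype.sum_sum_type, Fin.sum_univ_four, Fintype.sum_prod_type]
  have h1 : ∀ i : Fin m, ∑ b, rareShift p ℓ β τ (Sum.inr (i, b)) = 2 * ℓ / (2 * m + 1) := by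
    intro i
    cases hi : τ i <;> simp [rareShift, hi] <;> ring
  rw [Finset.sum_congr rfl fun i _ => h1 i]
  simp [rareShift]
  field_simp
  ring

theorem sum_rareStationary : ∑ s, rareStationary p ℓ β τ s = 1 := by
  simp only [rareStationary, Finset.sum_add_distrib, ← Finset.mul_sum, sum_bulkRow,
    sum_rareShift]
  ring

theorem sum_rareKernel (s : RareStates m) : ∑ t, rareKernel p ℓ β τ s t = 1 := by
  simp only [rareKernel, Finset.sum_add_distrib, ← Finset.mul_sum, sum_bulkRow, sum_slowFun]
  split_ifs
  · rw [sum_rareShift]; ring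
  · simp

namespace RareParams

theorem m_ge' (h : RareParams m p ℓ β) : (4 : ℝ) ≤ m := by exact_mod_cast h.m_ge

theorem p_pos (h : RareParams m p ℓ β) : 0 < p := by
  have := h.m_ge'
  have := h.p_eq
  have := h.ℓ_lt
  by_contra! hp
  nlinarith

theorem p_lt (h : RareParams m p ℓ β) : p < 1 / 100 := by
  have := h.m_ge'
  have := h.p_eq
  have := h.ℓ_gt
  by_contra! hp
  nlinarith

theorem bulkRow_pos (h : RareParams m p ℓ β) (s : RareStates m) : 0 < bulkRow p ℓ s := by
  have hD : (0 : ℝ) < 2 * m + 1 := by positivity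
  have hp := h.p_pos
  have := h.m_ge'
  have := h.p_eq
  have := h.ℓ_gt
  have h1 : 0 < (1 - p - ℓ) / (2 * m + 1) := div_pos (by nlinarith) hD
  rcases s with s | s
  · fin_cases s
    · simpa [bulkRow] using hp
    · simpa [bulkRow] using h1
    · simp [bulkRow]; linarith
    · simp [bulkRow]; linarith
  · simpa [bulkRow] using h1

theorem rareRow_nonneg (h : RareParams m p ℓ β) (s : RareStates m) : 0 ≤ bulkRow p ℓ s + rareShift p ℓ β τ s := by
  have hD : (0 : ℝ) < 2 * m + 1 := by positivity
  have hp := h.p_pos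
  have hp1 := h.p_lt
  have := h.ℓ_gt
  rcases s with s | ⟨i, b⟩
  · have h1 := h.bulkRow_pos (m := m) (Sum.inl 1)
    have h2 : 0 < ℓ / (2 * m + 1) := div_pos (by linarith) hD
    fin_cases s
    · simp [bulkRow, rareShift, hp.le]
    · simp [bulkRow, rareShift] at h1 ⊢; linarith
    · simp [bulkRow, rareShift]
    · simp [bulkRow, rareShift]
  · rw [rareRow_pair]
    refine div_nonneg (mul_nonneg (by linarith) ?_) hD.le
    have := h.β_le
    have := h.β_pos
    split_ifs <;> linarith

/-- Apart from the rare state, the stationary law is at least `4p`. -/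
theorem four_mul_le_rareStationary (h : RareParams m p ℓ β) (s : RareStates m) (hs : s ≠ Sum.inl 0) :
    4 * p ≤ rareStationary p ℓ β τ s := by
  have hD : (0 : ℝ) < 2 * m + 1 := by positivity
  have hp := h.p_pos
  have hp1 := h.p_lt
  have hℓ := h.ℓ_gt
  have hℓ1 := h.ℓ_lt
  have hm := h.m_ge'
  have hpe := h.p_eq
  have hβ := h.β_pos
  have hβ1 := h.β_le
  rcases s with s | ⟨i, b⟩
  · fin_cases s
    · exact absurd rfl hs
    · have : rareStationary p ℓ β τ (Sum.inl 1) = (1 - p - ℓ + p * ℓ) / (2 * m + 1) := by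
        simp [rareStationary, bulkRow, rareShift]; ring
      change _ ≤ rareStationary p ℓ β τ (Sum.inl 1)
      rw [this, le_div_iff₀ hD]
      nlinarith
    · simp [rareStationary, bulkRow, rareShift]; nlinarith
    · simp [rareStationary, bulkRow, rareShift]; nlinarith
  · have : rareStationary p ℓ β τ (Sum.inr (i, b)) = (1 - p - ℓ + p * (ℓ + (1 - p) * β *
        if b = τ i then 1 else -1)) / (2 * m + 1) := by
      simp only [rareStationary, bulkRow, rareShift, Sum.elim_inr]; ring
    rw [this, le_div_iff₀ hD]
    have h1 : -1 ≤ (1 - p) * β * (if b = τ i then (1 : ℝ) else -1) := by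
      have : (1 - p) * β ≤ 1 := by nlinarith
      have : 0 ≤ (1 - p) * β := mul_nonneg (by linarith) hβ.le
      split_ifs <;> linarith
    have h2 := mul_le_mul_of_nonneg_left h1 hp.le
    nlinarith

theorem p_le_rareStationary (h : RareParams m p ℓ β) (s : RareStates m) : p ≤ rareStationary p ℓ β τ s := by
  by_cases hs : s = Sum.inl 0
  · rw [hs, rareStationary_rare]
  · have := h.four_mul_le_rareStationary (τ := τ) s hs
    linarith [h.p_pos]

theorem rareStationary_pos (h : RareParams m p ℓ β) (s : RareStates m) : 0 < rareStationary p ℓ β τ s :=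
  h.p_pos.trans_le (h.p_le_rareStationary s)

/-- This is the condition `hκ` on the extra eigenvalue at `k = 1`. The sticky states contribute at
most `1` each and the `2m + 1` light states at most `1 / ((2m + 1)² p)` each, so the left side is at
most `2p + 1/(2m + 1)`, far below `ℓ ^ 2 > 0.81`. -/
theorem sum_rareShift_sq_div_le (h : RareParams m p ℓ β) :
    p * (1 - p) * ∑ s, rareShift p ℓ β τ s ^ 2 / rareStationary p ℓ β τ s ≤ ℓ ^ 2 := by
  have hD : (0 : ℝ) < 2 * m + 1 := by positivity
  have hp := h.p_pos
  have hp1 := h.p_lt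
  have hℓ := h.ℓ_gt
  have hℓ1 := h.ℓ_lt
  have hm := h.m_ge'
  have hβ := h.β_pos
  have hβ1 := h.β_le
  have hbd : ∀ s : RareStates m, s ≠ Sum.inl 0 → |rareShift p ℓ β τ s| ≤ 2 / (2 * m + 1) →
      rareShift p ℓ β τ s ^ 2 / rareStationary p ℓ β τ s ≤ 1 / ((2 * m + 1) ^ 2 * p) := by
    intro s hs hsv
    have h1 := h.four_mul_le_rareStationary (τ := τ) s hs
    have h2 : rareShift p ℓ β τ s ^ 2 ≤ (2 / (2 * m + 1)) ^ 2 := by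
      rw [← sq_abs]; exact pow_le_pow_left₀ (abs_nonneg _) hsv 2
    calc _ ≤ (2 / (2 * m + 1)) ^ 2 / (4 * p) := by gcongr
      _ = 1 / ((2 * m + 1) ^ 2 * p) := by field_simp; norm_num
  have h1 : rareShift p ℓ β τ (Sum.inl 1) ^ 2 / rareStationary p ℓ β τ (Sum.inl 1)
      ≤ 1 / ((2 * m + 1) ^ 2 * p) := by
    refine hbd _ (by simp) ?_
    have : rareShift p ℓ β τ (Sum.inl 1) = ℓ / (2 * m + 1) := by simp [rareShift]
    rw [this, abs_of_pos (div_pos (by linarith) hD)]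
    gcongr; linarith
  have h2 : ∀ x : Fin m × Bool, rareShift p ℓ β τ (Sum.inr x) ^ 2 /
      rareStationary p ℓ β τ (Sum.inr x) ≤ 1 / ((2 * m + 1) ^ 2 * p) := by
    intro x
    refine hbd _ (by simp) ?_
    simp only [rareShift, Sum.elim_inr]
    rw [abs_div, abs_of_pos hD]
    gcongr
    have h3 : (1 - p) * β ≤ 1 := by nlinarith
    have h4 : 0 ≤ (1 - p) * β := mul_nonneg (by linarith) hβ.le
    rw [abs_le]
    split_ifs <;> constructor <;> linarith
  have hsticky : ∀ j : Fin 4, 2 ≤ j → rareShift p ℓ β τ (Sum.inl j) ^ 2 /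
      rareStationary p ℓ β τ (Sum.inl j) ≤ 1 := by
    intro j hj
    rw [div_le_one (h.rareStationary_pos _)]
    fin_cases j
    · simp at hj
    · simp at hj
    · simp [rareStationary, bulkRow, rareShift]; nlinarith
    · simp [rareStationary, bulkRow, rareShift]; nlinarith
  have h0 : rareShift p ℓ β τ (Sum.inl 0) = 0 := by simp [rareShift]
  have hsum : ∑ s, rareShift p ℓ β τ s ^ 2 / rareStationary p ℓ β τ s
      ≤ 2 + (2 * m + 1) * (1 / ((2 * m + 1) ^ 2 * p)) := by
    rw [Fintype.sum_sum_type, Fin.sum_univ_four, h0]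
    have h5 := Finset.sum_le_sum fun x (_ : x ∈ Finset.univ) => h2 x
    rw [Finset.sum_const, Finset.card_univ, Fintype.card_prod, Fintype.card_fin,
      Fintype.card_bool, nsmul_eq_mul] at h5
    push_cast at h5
    have := hsticky 2 le_rfl
    have := hsticky 3 (by decide)
    have : (0 : ℝ) ^ 2 / rareStationary p ℓ β τ (Sum.inl 0) = 0 := by simp
    linarith
  have h6 : p * (1 - p) * (2 + (2 * m + 1) * (1 / ((2 * m + 1) ^ 2 * p)))
      = (1 - p) * (2 * p + 1 / (2 * m + 1)) := by
    field_simp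
  have h7 : 1 / (2 * m + 1 : ℝ) ≤ 1 / 9 := by
    apply one_div_le_one_div_of_le <;> linarith
  calc _ ≤ p * (1 - p) * (2 + (2 * m + 1) * (1 / ((2 * m + 1) ^ 2 * p))) := by
        refine mul_le_mul_of_nonneg_left hsum (mul_nonneg hp.le (by linarith))
    _ ≤ ℓ ^ 2 := by rw [h6]; nlinarith

theorem rareKernel_nonneg (h : RareParams m p ℓ β) (s t : RareStates m) : 0 ≤ rareKernel p ℓ β τ s t := by
  have hℓ := h.ℓ_gt
  by_cases hs : s = Sum.inl 0
  · have := h.rareRow_nonneg (τ := τ) t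
    simpa [rareKernel, hs, slowFun] using this
  · rw [rareKernel, if_neg hs, add_zero]
    have hf : |slowFun s| ≤ 1 := by
      rcases s with s | s
      · fin_cases s <;> simp [slowFun]
      · simp [slowFun]
    rw [abs_le] at hf
    obtain ⟨hf1, hf2⟩ := hf
    generalize slowFun s = y at hf1 hf2
    have ht := h.bulkRow_pos t
    rcases t with t | t
    · fin_cases t
      · simpa [slowFun] using ht.le
      · simpa [slowFun] using ht.le
      · simp [slowFun, bulkRow]; nlinarith
      · simp [slowFun, bulkRow]; nlinarith
    · simpa [slowFun] using ht.le

theorem rareKernel_neutral_pos (h : RareParams m p ℓ β) (s : RareStates m) : 0 < rareKernel p ℓ β τ s (Sum.inl 1) := by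
  have h1 := h.bulkRow_pos (m := m) (Sum.inl 1)
  have h2 : 0 < ℓ / (2 * m + 1) := div_pos (by linarith [h.ℓ_gt]) (by positivity)
  have h3 : rareShift p ℓ β τ (Sum.inl 1) = ℓ / (2 * m + 1) := by simp [rareShift]
  have h4 : slowFun (m := m) (Sum.inl 1) = 0 := by simp [slowFun]
  rw [rareKernel, h3, h4]
  split_ifs <;> linarith

theorem neutral_rareKernel_pos (h : RareParams m p ℓ β) (t : RareStates m) : 0 < rareKernel p ℓ β τ (Sum.inl 1) t := by
  have := h.bulkRow_pos t
  simpa [rareKernel, slowFun] using this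

/-- The Bhattacharyya coefficient of the rows of the rare state for two adjacent bit vectors. -/
theorem rareRow_affinity (h : RareParams m p ℓ β) (i : Fin m) :
    1 - 2 * β ^ 2 / (2 * m + 1) ≤ ∑ t, √(rareKernel p ℓ β τ (Sum.inl 0) t *
      rareKernel p ℓ β (flipBit i τ) (Sum.inl 0) t) := by
  have hD : (0 : ℝ) < 2 * m + 1 := by positivity
  have hp := h.p_pos
  have hp1 := h.p_lt
  have hβ := h.β_pos
  have hβ1 := h.β_le
  have hpair : ∀ (σ : Fin m → Bool) (j : Fin m) (b : Bool),
      rareKernel p ℓ β σ (Sum.inl 0) (Sum.inr (j, b))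
        = (1 - p) * (1 + β * if b = σ j then 1 else -1) / (2 * m + 1) := by
    intro σ j b
    rw [← rareRow_pair (ℓ := ℓ)]; simp [rareKernel, slowFun]
  have key : ∀ t : RareStates m, (rareKernel p ℓ β τ (Sum.inl 0) t +
      rareKernel p ℓ β (flipBit i τ) (Sum.inl 0) t) / 2
      - Sum.elim (fun _ => 0) (fun x => if x.1 = i then β ^ 2 / (2 * m + 1) else 0) t
      ≤ √(rareKernel p ℓ β τ (Sum.inl 0) t * rareKernel p ℓ β (flipBit i τ) (Sum.inl 0) t) := by
    intro t
    have heq : rareKernel p ℓ β (flipBit i τ) (Sum.inl 0) t = rareKernel p ℓ β τ (Sum.inl 0) t →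
        (rareKernel p ℓ β τ (Sum.inl 0) t + rareKernel p ℓ β (flipBit i τ) (Sum.inl 0) t) / 2
        ≤ √(rareKernel p ℓ β τ (Sum.inl 0) t * rareKernel p ℓ β (flipBit i τ) (Sum.inl 0) t) := by
      intro h1
      rw [h1, Real.sqrt_mul_self (h.rareKernel_nonneg _ _)]; linarith
    rcases t with t | ⟨j, b⟩
    · simp only [Sum.elim_inl, sub_zero]
      exact heq (by simp [rareKernel, rareShift])
    · simp only [Sum.elim_inr]
      split_ifs with hj
      · subst hj
        have h1 : rareKernel p ℓ β τ (Sum.inl 0) (Sum.inr (j, b)) +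
            rareKernel p ℓ β (flipBit j τ) (Sum.inl 0) (Sum.inr (j, b))
            = 2 * ((1 - p) / (2 * m + 1)) := by
          rw [hpair, hpair, flipBit_same]
          cases b <;> cases τ j <;> simp <;> ring
        have h2 : rareKernel p ℓ β τ (Sum.inl 0) (Sum.inr (j, b)) *
            rareKernel p ℓ β (flipBit j τ) (Sum.inl 0) (Sum.inr (j, b))
            = ((1 - p) / (2 * m + 1)) ^ 2 * (1 - β ^ 2) := by
          rw [hpair, hpair, flipBit_same]
          cases b <;> cases τ j <;> simp <;> ring
        rw [h1, h2]
        have hb0 : 0 ≤ 1 - β ^ 2 := by nlinarith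
        have hq : 0 ≤ (1 - p) / (2 * m + 1 : ℝ) := div_nonneg (by linarith) hD.le
        have h3 : (1 - p) / (2 * m + 1 : ℝ) * β ^ 2 ≤ β ^ 2 / (2 * m + 1) := by
          rw [div_mul_eq_mul_div]; gcongr; nlinarith [sq_nonneg β]
        -- Uses `√(1 - β²) ≥ 1 - β²`; each of the two states of pair `i` thus loses at most `β² /
        -- (2m + 1)`.
        refine le_trans (b := (1 - p) / (2 * m + 1) * (1 - β ^ 2)) (by linarith) ?_
        refine Real.le_sqrt_of_sq_le ?_
        rw [mul_pow]
        exact mul_le_mul_of_nonneg_left (by nlinarith [sq_nonneg β]) (sq_nonneg _)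
      · rw [sub_zero]
        exact heq (by rw [hpair, hpair, flipBit_of_ne hj])
  refine le_trans (le_of_eq ?_) (Finset.sum_le_sum fun t _ => key t)
  have hloss : ∑ x : Fin m × Bool, (if x.1 = i then β ^ 2 / (2 * m + 1 : ℝ) else 0)
      = 2 * β ^ 2 / (2 * m + 1) := by
    rw [Fintype.sum_prod_type_right]
    simp
    ring
  rw [Finset.sum_sub_distrib, ← Finset.sum_div, Finset.sum_add_distrib, sum_rareKernel,
    sum_rareKernel, Fintype.sum_sum_type]
  simp only [Sum.elim_inl, Sum.elim_inr, Finset.sum_const_zero, hloss]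
  ring

end RareParams

end RareStateChain

/-! ### The lower bound from the rare state chain. -/

section RareStateLowerBound

open Matrix

variable {d m : ℕ} {p ℓ β : ℝ} {τ : Fin m → Bool}

/-- The rare state chain, transported to `Fin d`. -/
noncomputable def rareChain (e : Fin d ≃ RareStates m) (p ℓ β : ℝ) (τ : Fin m → Bool) :
    Matrix (Fin d) (Fin d) ℝ :=
  of fun i j => rareKernel p ℓ β τ (e i) (e j)

variable {e : Fin d ≃ RareStates m}

theorem sum_rareChain (i : Fin d) :
    ∑ j, rareChain e p ℓ β τ i j = 1 := by
  rw [← sum_rareKernel (τ := τ) (e i), ← e.sum_comp]; rfl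

/-- Two steps are needed, through the neutral state: a sticky state never moves directly to the
other one. -/
theorem isErgodicChain_rareChain (h : RareParams m p ℓ β) :
    IsErgodicChain (rareChain e p ℓ β τ) := by
  refine ⟨mem_rowStochastic_iff_sum.2 ⟨fun i j => h.rareKernel_nonneg _ _, sum_rareChain⟩,
    2, by norm_num, fun i j => ?_⟩
  rw [pow_two, mul_apply]
  refine Finset.sum_pos' (fun l _ => mul_nonneg (h.rareKernel_nonneg _ _)
    (h.rareKernel_nonneg _ _)) ⟨e.symm (Sum.inl 1), Finset.mem_univ _, ?_⟩
  simp only [rareChain, of_apply, Equiv.apply_symm_apply]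
  exact mul_pos (h.rareKernel_neutral_pos _) (h.neutral_rareKernel_pos _)

theorem rareChain_eq (i j : Fin d) : rareChain e p ℓ β τ i j
    = rareStationary p ℓ β τ (e j) + ℓ / 2 * slowFun (e i) * slowFun (e j)
      + ((if i = e.symm (Sum.inl 0) then 1 else 0)
        - rareStationary p ℓ β τ (e (e.symm (Sum.inl 0)))) * rareShift p ℓ β τ (e j) := by
  rw [Equiv.apply_symm_apply, rareStationary_rare, rareChain, of_apply, rareKernel_eq]
  simp only [Equiv.eq_symm_apply]

theorem sum_rareStationary_mul_slowFun (p ℓ β : ℝ) (τ : Fin m → Bool) :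
    ∑ s, rareStationary p ℓ β τ s * slowFun s = 0 := by
  simp only [rareStationary_mul_slowFun, ← Finset.mul_sum, sum_slowFun, mul_zero]

theorem isStationary_rareChain (h : RareParams m p ℓ β) :
    IsStationary (rareChain e p ℓ β τ) fun i => rareStationary p ℓ β τ (e i) := by
  have h1 : ∑ i, rareStationary p ℓ β τ (e i) = 1 := by
    rw [e.sum_comp, sum_rareStationary]
  refine ⟨⟨fun i => (h.rareStationary_pos _).le, h1⟩, ?_⟩
  ext j
  have h2 : ∀ i, rareStationary p ℓ β τ (e i) * rareChain e p ℓ β τ i j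
      = rareStationary p ℓ β τ (e i) * rareStationary p ℓ β τ (e j)
        + rareStationary p ℓ β τ (e i) * slowFun (e i) * (ℓ / 2 * slowFun (e j))
        + (rareStationary p ℓ β τ (e i) * if i = e.symm (Sum.inl 0) then 1 else 0)
          * rareShift p ℓ β τ (e j)
        - rareStationary p ℓ β τ (e i) * (rareStationary p ℓ β τ (e (e.symm (Sum.inl 0)))
          * rareShift p ℓ β τ (e j)) := fun i => by
    rw [rareChain_eq]; ring
  have h3 : ∑ i, rareStationary p ℓ β τ (e i) * slowFun (e i) = 0 := by
    rw [e.sum_comp fun s => rareStationary p ℓ β τ s * slowFun s,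
      sum_rareStationary_mul_slowFun]
  simp only [vecMul, dotProduct]
  rw [Finset.sum_congr rfl fun i _ => h2 i, Finset.sum_sub_distrib, Finset.sum_add_distrib,
    Finset.sum_add_distrib, ← Finset.sum_mul, ← Finset.sum_mul, ← Finset.sum_mul,
    ← Finset.sum_mul, h1, h3]
  simp

theorem hasPseudoSpectralGap_rareChain (h : RareParams m p ℓ β) :
    HasPseudoSpectralGap (rareChain e p ℓ β τ) (fun i => rareStationary p ℓ β τ (e i))
      (1 - ℓ ^ 2) := by
  have hd : 3 ≤ d := by
    have := Fintype.card_congr e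
    simp at this
    omega
  refine hasPseudoSpectralGap_of_rank_three hd (e.symm (Sum.inl 0)) _
    (fun i => slowFun (e i)) (fun i => rareShift p ℓ β τ (e i)) (c := (1 - p) * ℓ / 2)
    (by linarith [h.ℓ_gt]) h.ℓ_lt.le (fun i => h.rareStationary_pos _) ?_ ?_ ?_ ?_ ?_ ?_ ?_ ?_
    (fun i => rareStationary_mul_slowFun _) ?_ rareChain_eq
  · rw [e.sum_comp, sum_rareStationary]
  · rw [e.sum_comp, sum_rareShift]
  · simp [rareShift]
  · rw [e.sum_comp, sum_slowFun]
  · rw [e.sum_comp fun s => rareStationary p ℓ β τ s * slowFun s,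
      sum_rareStationary_mul_slowFun]
  · rw [e.sum_comp fun s => slowFun s * rareShift p ℓ β τ s, sum_slowFun_mul_rareShift]
  · rw [e.sum_comp fun s => slowFun s * slowFun s, sum_slowFun_sq]
  · simp [slowFun]
  · rw [e.sum_comp fun s => rareShift p ℓ β τ s ^ 2 / rareStationary p ℓ β τ s,
      Equiv.apply_symm_apply, rareStationary_rare]
    exact h.sum_rareShift_sq_div_le

theorem minProb_rareStationary (h : RareParams m p ℓ β) :
    minProb (fun i => rareStationary p ℓ β τ (e i)) = p := by
  have : Nonempty (Fin d) := ⟨e.symm (Sum.inl 0)⟩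
  refine le_antisymm ?_ (le_ciInf fun i => h.p_le_rareStationary _)
  refine (ciInf_le (Set.finite_range _).bddBelow (e.symm (Sum.inl 0))).trans ?_
  beta_reduce
  rw [Equiv.apply_symm_apply, rareStationary_rare]

/-- The coefficient is the mass kept by the geometric mean of the two kernels, which is lost only on
leaving the rare state. Starting at the neutral state avoids an initial loss. -/
theorem affinity_rareChain (h : RareParams m p ℓ β) (n : ℕ) (i : Fin m) (τ : Fin m → Bool) :
    1 - n * (p * (2 * β ^ 2 / (2 * m + 1))) ≤ ∑ x : Fin (n + 1) → Fin d,
      √(pathProb (rareChain e p ℓ β τ) (Pi.single (e.symm (Sum.inl 1)) 1) x *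
        pathProb (rareChain e p ℓ β (flipBit i τ)) (Pi.single (e.symm (Sum.inl 1)) 1) x) := by
  have hnn : ∀ τ i j, 0 ≤ rareChain e p ℓ β τ i j := fun τ i j => h.rareKernel_nonneg _ _
  simp only [sqrt_pathProb_mul (hnn τ) (hnn (flipBit i τ)), sum_pathProb_single]
  set K : Matrix (Fin d) (Fin d) ℝ :=
    of fun a b => √(rareChain e p ℓ β τ a b * rareChain e p ℓ β (flipBit i τ) a b)
  have hne : e.symm (Sum.inl 1) ≠ e.symm (Sum.inl 0) := by simp
  have := one_sub_le_pow_mulVec_one (K := K) (o := e.symm (Sum.inl 0)) (p := p)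
    (η := 2 * β ^ 2 / (2 * m + 1)) h.p_pos.le (by positivity) (fun a b => Real.sqrt_nonneg _)
    ?_ ?_ ?_ ?_ n (e.symm (Sum.inl 1))
  · rwa [if_neg hne, sub_zero] at this
  · intro a
    simp only [K, of_apply, rareChain, Equiv.apply_symm_apply, rareKernel_rare]
    rw [Real.sqrt_mul_self h.p_pos.le]
  · intro a ha
    rw [← sum_rareChain (e := e) (τ := τ) a]
    refine Finset.sum_congr rfl fun b _ => ?_
    have hae : e a ≠ Sum.inl 0 := fun hc => ha (by rw [← hc, Equiv.symm_apply_apply])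
    have : rareChain e p ℓ β (flipBit i τ) a b = rareChain e p ℓ β τ a b := by
      simp [rareChain, rareKernel, hae]
    simp only [K, of_apply, this]
    exact Real.sqrt_mul_self (hnn τ a b)
  · refine (h.rareRow_affinity (τ := τ) i).trans (le_of_eq ?_)
    rw [← e.sum_comp]
    simp [K, rareChain]
  · have h1 : ∀ b, K (e.symm (Sum.inl 0)) b ≤ (rareChain e p ℓ β τ (e.symm (Sum.inl 0)) b
        + rareChain e p ℓ β (flipBit i τ) (e.symm (Sum.inl 0)) b) / 2 := by
      intro b
      simp only [K, of_apply]
      have hb := hnn τ (e.symm (Sum.inl 0)) b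
      have hb' := hnn (flipBit i τ) (e.symm (Sum.inl 0)) b
      refine Real.sqrt_le_iff.2 ⟨by linarith, ?_⟩
      nlinarith [sq_nonneg (rareChain e p ℓ β τ (e.symm (Sum.inl 0)) b
        - rareChain e p ℓ β (flipBit i τ) (e.symm (Sum.inl 0)) b)]
    refine (Finset.sum_le_sum fun b _ => h1 b).trans ?_
    rw [← Finset.sum_div, Finset.sum_add_distrib, sum_rareChain, sum_rareChain]
    norm_num

/-- An approximation of the rare state chain determines most of its bits. -/
theorem hamming_le_of_tvNorm_lt (h : RareParams m p ℓ β) {A : Fin d → Fin d → ℝ} {ε : ℝ}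
    (hβε : β = 16 * ε) (hA : tvNorm (rareChain e p ℓ β τ - Matrix.of A) < ε) :
    (∑ i, if decide (A (e.symm (Sum.inl 0)) (e.symm (Sum.inr (i, false)))
      < (1 - p) / (2 * m + 1)) = τ i then (0 : ℝ) else 1) ≤ 3 / 20 * m := by
  set o := e.symm (Sum.inl 0)
  set q : ℝ := (1 - p) / (2 * m + 1) with hq
  have hm := h.m_ge'
  have hp1 := h.p_lt
  have hβ := h.β_pos
  have hD : (0 : ℝ) < 2 * m + 1 := by positivity
  have hq0 : 0 < q := div_pos (by linarith) hD
  set G : Fin d → ℝ := fun j => |(rareChain e p ℓ β τ - Matrix.of A) o j|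
  have h1 : ∑ j, G j < ε := (row_sum_le_tvNorm _ o).trans_lt hA
  have h2 : ∑ i : Fin m, G (e.symm (Sum.inr (i, false))) ≤ ∑ j, G j := by
    have hinj : Function.Injective fun i : Fin m => e.symm (Sum.inr (i, false)) := by
      intro i j hij; simpa using hij
    rw [← Finset.sum_image (f := G) (s := Finset.univ) (g := fun i : Fin m =>
      e.symm (Sum.inr (i, false))) (fun i _ j _ hij => hinj hij)]
    exact Finset.sum_le_sum_of_subset_of_nonneg (Finset.subset_univ _)
      fun j _ _ => abs_nonneg _
  have h3 : ∀ i : Fin m, q * β * (if decide (A o (e.symm (Sum.inr (i, false))) < q) = τ i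
      then (0 : ℝ) else 1) ≤ G (e.symm (Sum.inr (i, false))) := by
    intro i
    split_ifs with hi
    · rw [mul_zero]; exact abs_nonneg _
    · rw [mul_one]
      have hM : rareChain e p ℓ β τ o (e.symm (Sum.inr (i, false)))
          = q * (1 + β * if false = τ i then 1 else -1) := by
        have := rareRow_pair (p := p) (ℓ := ℓ) (β := β) (τ := τ) i false
        rw [hq, div_mul_eq_mul_div, ← this]
        simp [rareChain, rareKernel, o, slowFun]
      simp only [G, Matrix.sub_apply, of_apply, hM]
      cases hτ : τ i
      · rw [hτ] at hi
        simp only [decide_eq_false_iff_not, not_not] at hi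
        refine le_trans ?_ (le_abs_self _)
        simp; linarith
      · rw [hτ] at hi
        simp only [decide_eq_true_eq, not_lt] at hi
        refine le_trans ?_ (neg_le_abs _)
        simp; linarith
  have h4 := Finset.sum_le_sum fun i (_ : i ∈ Finset.univ) => h3 i
  rw [← Finset.mul_sum] at h4
  set W := ∑ i, if decide (A o (e.symm (Sum.inr (i, false))) < q) = τ i then (0 : ℝ) else 1
  -- Each wrong bit costs `q β` in the rare row, whose total error is below `ε = β / 16`. Thus `W <
  -- (2m + 1) / (16 (1 - p))`, which is below `3m/20` for `m ≥ 4` and `p < 1/100`.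
  have h5 : q * β * W < β / 16 := by rw [hβε] at h4 ⊢; linarith
  have h6 : (1 - p) * W < (2 * m + 1) / 16 := by
    rw [hq] at h5
    have : (1 - p) / (2 * m + 1) * β * W = β * ((1 - p) * W) / (2 * m + 1) := by ring
    rw [this, div_lt_iff₀ hD] at h5
    nlinarith
  nlinarith

theorem rare_lower_bound {ε γ : ℝ} (hε : 0 < ε) (hε1 : ε < 1 / 32) (hγ : 0 < γ)
    (hγ1 : γ < 1 / 8) (hd : d = 2 * m + 4) (hm : 4 ≤ m) {L : Learner d}
    {m₀ : Matrix (Fin d) (Fin d) ℝ → (Fin d → ℝ) → ℕ∞} (hL : IsLearner ε (1 / 10) L m₀)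
    (hp : p = (1 - √(1 - γ)) / (8 * (2 * m + 1))) :
    ∃ (M : Matrix (Fin d) (Fin d) ℝ) (π μ : Fin d → ℝ), IsErgodicChain M ∧ IsStationary M π ∧
      HasPseudoSpectralGap M π γ ∧ minProb π = p ∧ μ ∈ stdSimplex ℝ (Fin d) ∧
      ENNReal.ofReal (1 / 32768 * (d / (ε ^ 2 * p))) ≤ (m₀ M μ : ℝ≥0∞) := by
  obtain ⟨e⟩ : Nonempty (Fin d ≃ RareStates m) :=
    ⟨Fintype.equivOfCardEq (by simp [hd]; ring)⟩
  set ℓ := √(1 - γ)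
  have hℓ0 : 0 ≤ ℓ := Real.sqrt_nonneg _
  have hℓ2 : ℓ ^ 2 = 1 - γ := Real.sq_sqrt (by linarith)
  have hmR : (4 : ℝ) ≤ m := by exact_mod_cast hm
  have h : RareParams m p ℓ (16 * ε) :=
    ⟨hm, by nlinarith, by nlinarith, by rw [hp]; field_simp, by linarith, by linarith⟩
  set a : Fin d := e.symm (Sum.inl 1)
  have hμ : (Pi.single a 1 : Fin d → ℝ) ∈ stdSimplex ℝ (Fin d) := single_mem_stdSimplex ℝ a
  have hp0 := h.p_pos
  have key : ∀ n : ℕ, (n : ℝ) ≤ 1 / 32768 * (d / (ε ^ 2 * p)) →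
      ∃ τ, successProb L ε (rareChain e p ℓ (16 * ε) τ) (Pi.single a 1) n < 9 / 10 := by
    intro n hn
    -- Here `32768 = 64 · 2 · 16²`, and `d = 2m + 4 ≤ 2 (2m + 1)`; this yields the affinity `31/32`
    -- needed in Le Cam's bound.
    have hsmall : n * (p * (2 * (16 * ε) ^ 2 / (2 * m + 1))) ≤ 1 / 32 := by
      calc (n : ℝ) * (p * (2 * (16 * ε) ^ 2 / (2 * m + 1)))
          ≤ 1 / 32768 * (d / (ε ^ 2 * p)) * (p * (2 * (16 * ε) ^ 2 / (2 * m + 1))) := by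
            gcongr
        _ = (d : ℝ) / (64 * (2 * m + 1)) := by field_simp; ring
        _ ≤ 1 / 32 := by
            rw [div_le_iff₀ (by positivity), hd]; push_cast; linarith
    have hnn : ∀ τ i j, 0 ≤ rareChain e p ℓ (16 * ε) τ i j := fun τ i j =>
      h.rareKernel_nonneg _ _
    set ψ : (Fin d → Fin d → ℝ) → (Fin m → Bool) := fun A i =>
      decide (A (e.symm (Sum.inl 0)) (e.symm (Sum.inr (i, false))) < (1 - p) / (2 * m + 1))
    have hψ : Measurable ψ := measurable_decide_lt _ _ _
    obtain ⟨τ, hτ⟩ := exists_success_lt_of_hamming (by omega) (X := Fin (n + 1) → Fin d)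
      (P := fun τ x => pathProb (rareChain e p ℓ (16 * ε) τ) (Pi.single a 1) x)
      (q := fun x b => decodeLaw L ψ x b)
      (fun τ x => pathProb_nonneg (hnn τ) a x)
      (fun τ => sum_pathProb_eq_one (sum_rareChain) n a)
      (fun x b => decodeLaw_nonneg L ψ x b) (fun x => sum_univ_decodeLaw L hψ x)
      (fun i τ => le_trans (by linarith) (affinity_rareChain h n i τ))
    refine ⟨τ, lt_of_le_of_lt (successProb_le L hψ (hnn τ) a _ fun A hA => ?_) hτ⟩
    exact Finset.mem_filter.2 ⟨Finset.mem_univ _, hamming_le_of_tvNorm_lt h rfl hA⟩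
  obtain ⟨τ, hτ⟩ := exists_le_sampleComplexity (T := Fin m → Bool) hL
    (M := fun τ => rareChain e p ℓ (16 * ε) τ) (μ := Pi.single a 1)
    (fun τ => isErgodicChain_rareChain h) hμ (by positivity) key
  refine ⟨rareChain e p ℓ (16 * ε) τ, _, Pi.single a 1, isErgodicChain_rareChain h,
    isStationary_rareChain h, ?_, minProb_rareStationary h, hμ, hτ⟩
  have := hasPseudoSpectralGap_rareChain (e := e) (τ := τ) h
  rwa [hℓ2, sub_sub_cancel] at this

end RareStateLowerBound

end MarkovLearning

theorem theorem2 :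
    ∃ c : ℝ, 0 < c ∧
      ∀ (ε γ : ℝ) (d k : ℕ), 0 < ε → ε < 1 / 32 → 0 < γ → γ < 1 / 8 → 2 ≤ k → d = 6 * k →
        ∃ pmin : ℝ, 0 < pmin ∧
          ∀ (L : MarkovLearning.Learner d)
            (m₀ : Matrix (Fin d) (Fin d) ℝ → (Fin d → ℝ) → ℕ∞),
            MarkovLearning.IsLearner ε (1 / 10) L m₀ →
              ∃ (M : Matrix (Fin d) (Fin d) ℝ) (π μ : Fin d → ℝ),
                MarkovLearning.IsErgodicChain M ∧
                MarkovLearning.IsStationary M π ∧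
                MarkovLearning.HasPseudoSpectralGap M π γ ∧
                MarkovLearning.minProb π = pmin ∧
                μ ∈ stdSimplex ℝ (Fin d) ∧
                ENNReal.ofReal
                    (c * max ((d : ℝ) / (ε ^ 2 * pmin)) (Real.log (d : ℝ) / (γ * pmin))) ≤
                  (m₀ M μ : ℝ≥0∞) := by
  refine ⟨1 / 32768, by norm_num, fun ε γ d k hε hε1 hγ hγ1 hk hd => ?_⟩
  have hd0 : (0 : ℝ) < d := by exact_mod_cast (by omega : 0 < d)
  have hlog : 0 ≤ Real.log d := Real.log_nonneg (by exact_mod_cast (by omega : 1 ≤ d))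
  have hsplit : ∀ p : ℝ, d / (ε ^ 2 * p) = d / ε ^ 2 / p ∧
      Real.log d / (γ * p) = Real.log d / γ / p := fun p => by
    rw [div_div, div_div]; exact ⟨rfl, rfl⟩
  -- The case depends on neither the learner nor `pmin`, so `pmin` can be fixed before the learner.
  -- The parameters are `m = 3k - 2` pairs for the rare chain and `N = 3k` for the reset chain.
  rcases le_total (Real.log d / γ) (d / ε ^ 2) with hle | hle
  · have hs : √(1 - γ) < 1 := by
      rw [Real.sqrt_lt' one_pos]; linarith
    have hp : 0 < (1 - √(1 - γ)) / (8 * (2 * ((3 * k - 2 : ℕ) : ℝ) + 1)) :=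
      div_pos (by linarith) (by positivity)
    refine ⟨_, hp, fun L m₀ hL => ?_⟩
    rw [max_eq_left]
    · exact MarkovLearning.rare_lower_bound hε hε1 hγ hγ1 (by omega) (by omega) hL rfl
    · rw [(hsplit _).1, (hsplit _).2]
      gcongr
  · refine ⟨1 / d, by positivity, fun L m₀ hL => ?_⟩
    obtain ⟨M, π, μ, h1, h2, h3, h4, h5, h6⟩ := MarkovLearning.reset_lower_bound
      (N := 3 * k) hε1 hγ hγ1 (by omega) (by omega) hL
    refine ⟨M, π, μ, h1, h2, h3, h4, h5, le_trans (ENNReal.ofReal_le_ofReal ?_) h6⟩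
    rw [max_eq_right]
    · gcongr; norm_num
    · rw [(hsplit _).1, (hsplit _).2]
      gcongr
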